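/- For $\alpha\in(0,1)$, an integer $n\ge 1$ and $b\in(0,1]$ put $$\Lambda_n(b)=\frac1b\int_0^{\infty}\frac{J_n(bt)J_n(t)}{t^{1-\alpha}}\,dt,\qquad \Theta_n=\Lambda_1(1)-\Lambda_n(1),$$ where $J_n$ is the Bessel function of the first kind; for $\Omega\in\mathbb R$ let $$M_n^\alpha=\begin{pmatrix}\Omega-\Theta_n+b^2\Lambda_1(b) & -b^2\Lambda_n(b)\\ b\Lambda_n(b) & b\Omega+b^{1-\alpha}\Theta_n-b\Lambda_1(b)\end{pmatrix}.$$ Let $\gamma$ be Euler's constant, $\zeta$ the Riemann zeta function, and $$c_\alpha=\sum_{m=1}^\infty\frac{\alpha^{2m+1}}{2^{2m}(2m+1)}\zeta(2m+1),\qquad \kappa=\Big(1-\frac\alpha2\Big)\Lambda_1(1)\,e^{\alpha\gamma+c_\alpha}.$$ Let $\alpha,b\in(0,1)$. Then the integrals defining $\Lambda_n(\beta)$, $n\ge1$, $\beta\in(0,1]$, converge absolutely, and: 1. For all $n\ge1$, $\Theta_n\ge0$ and $\Lambda_n(b)\ge0$. For each $n\ge1$ the map $\beta\in(0,1)\mapsto\Lambda_n(\beta)$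 is strictly increasing; $n\ge1\mapsto\Theta_n$ is strictly increasing and $n\ge1\mapsto\Lambda_n(b)$ is strictly decreasing. 2. For every $n\ge2$ (with $b$ fixed and $\alpha$ varying in $(0,1)$), $$\lim_{\alpha\to0}\Theta_n=\frac{n-1}{2n},\qquad \lim_{\alpha\to0}\Lambda_n(b)=\frac{b^{n-1}}{2n},$$ $$\lim_{\alpha\to1}\Theta_n=\frac2\pi\sum_{k=1}^{n-1}\frac1{2k+1},\qquad \lim_{\alpha\to1}\Lambda_n(b)=\frac1b\int_0^{\infty}J_n(bt)J_n(t)\,dt,$$ the last integral being a convergent improper integral $\lim_{R\to\infty}\int_0^R$. 3. As $n\to\infty$, $$\Lambda_n(b)=O(b^{n-1}),\qquad \Lambda_n(b)\to0,\qquad \Theta_n=\Lambda_1(1)-\frac{\kappa}{n^{1-\alpha}}+O\Big(\frac1{n^{2-\alpha}}\Big),\qquad \Theta_n\to\Lambda_1(1).$$ 4. For every $\Omega\in\mathbb R$, as $n\to\infty$, $$\det M_n^\alpha=\mu+\frac{\nu}{n^{1-\alpha}}-\frac{b^{1-\alpha}\kappa^2}{n^{2-2\alpha}}+O\Big(\frac1{n^{2-\alpha}}\Big),\qquad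 \det M_n^\alpha\to\mu,$$ where $$\mu=\big(\Omega-\Lambda_1(1)+b^2\Lambda_1(b)\big)\big(b\Omega+b^{1-\alpha}\Lambda_1(1)-b\Lambda_1(b)\big),$$ $$\nu=\Big(1-\frac\alpha2\Big)\Lambda_1(1)\Big(2b^{1-\alpha}\Lambda_1(1)+(b-b^{1-\alpha})\Omega-b(1+b^{2-\alpha})\Lambda_1(b)\Big)e^{\alpha\gamma+c_\alpha}.$$ -/

import Mathlib

open Set Filter Topology Asymptotics MeasureTheory

noncomputable section

namespace VState

/-- The Bessel function of the first kind `J_n` of integer order `n ≥ 0` at a real argument,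
by its (everywhere absolutely convergent) power series. -/
def besselJ (n : ℕ) (x : ℝ) : ℝ :=
  ∑' k : ℕ, (-1 : ℝ) ^ k / ((k.factorial : ℝ) * ((n + k).factorial : ℝ)) * (x / 2) ^ (2 * k + n)

/-- The integrand `J_n(bt) J_n(t) / t^{1-α}`. -/
def lambdaIntegrand (α : ℝ) (n : ℕ) (b t : ℝ) : ℝ :=
  besselJ n (b * t) * besselJ n t / t ^ (1 - α)

/-- `Λ_n(b) = (1/b) ∫_0^∞ J_n(bt) J_n(t) / t^{1-α} dt`. -/
def Lam (α : ℝ) (n : ℕ) (b : ℝ) : ℝ :=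
  1 / b * ∫ t in Ioi (0 : ℝ), lambdaIntegrand α n b t

/-- `Θ_n = Λ_1(1) - Λ_n(1)`. -/
def Theta (α : ℝ) (n : ℕ) : ℝ :=
  Lam α 1 1 - Lam α n 1

/-- The matrix `M_n^α`. -/
def M (α b Ω : ℝ) (n : ℕ) : Matrix (Fin 2) (Fin 2) ℝ :=
  !![Ω - Theta α n + b ^ 2 * Lam α 1 b, -b ^ 2 * Lam α n b;
     b * Lam α n b, b * Ω + b ^ (1 - α) * Theta α n - b * Lam α 1 b]

/-- `c_α = ∑_{m ≥ 1} α^{2m+1} / (2^{2m} (2m+1)) · ζ(2m+1)`, with the summation index shifted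
so that `j = m - 1` starts at `0`. -/
def cAlpha (α : ℝ) : ℝ :=
  ∑' j : ℕ, α ^ (2 * (j + 1) + 1) / (2 ^ (2 * (j + 1)) * (2 * ((j : ℝ) + 1) + 1)) *
    (riemannZeta (2 * ((j : ℂ) + 1) + 1)).re

/-- `κ = (1 - α/2) Λ_1(1) e^{αγ + c_α}`, with `γ` Euler's constant. -/
def kappa (α : ℝ) : ℝ :=
  (1 - α / 2) * Lam α 1 1 * Real.exp (α * Real.eulerMascheroniConstant + cAlpha α)

/-- The limit `μ` of `det M_n^α`. -/
def mu (α b Ω : ℝ) : ℝ :=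
  (Ω - Lam α 1 1 + b ^ 2 * Lam α 1 b) *
    (b * Ω + b ^ (1 - α) * Lam α 1 1 - b * Lam α 1 b)

/-- The coefficient `ν` of `1 / n^{1-α}` in the expansion of `det M_n^α`. -/
def nu (α b Ω : ℝ) : ℝ :=
  (1 - α / 2) * Lam α 1 1 *
    (2 * b ^ (1 - α) * Lam α 1 1 + (b - b ^ (1 - α)) * Ω
      - b * (1 + b ^ (2 - α)) * Lam α 1 b) *
    Real.exp (α * Real.eulerMascheroniConstant + cAlpha α)

end VState

end

/-!
By the addition theorem, `J_n(bt) J_n(t)` is the `n`-th Fourier coefficient of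
`θ ↦ J_0(t √(1 + b² - 2b cos θ))`, and `t ^ (α - 2)` is a superposition of Gaussians
`exp (-t² / (4u))`. Integrating in `t` first therefore leaves, with `s = α / 2`, the `n`-th Fourier
coefficient of `(1 + b² - 2b cos θ) ^ (-s) = |1 - b e^{iθ}| ^ (-2s)`, and expanding the two factors
`(1 - b e^{±iθ}) ^ (-s)` by the binomial series turns it into an Euler integral: `Λ_n(b)` is a
positive constant times
`b ^ (n - 1) ∫₀¹ x ^ (n + s - 1) (1 - x) ^ (-s) (1 - b² x) ^ (-s) dx`.
The integrand increases with `b` and decreases with `n`, which gives the signs, the monotonicity,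
the bound `O(b ^ (n - 1))` and, letting `s → 0`, the limits as `α → 0`.

At `b = 1` the Euler integral is a Beta integral, so `Λ_n(1)` is a constant times
`Γ(n + s) / Γ(n + 1 - s)`. Log-convexity of `Γ` compares this quotient with `n ^ (2s - 1)`, and
Euler's limit formula for `Γ(1 - s) / Γ(1 + s)`, expanded in odd zeta values, identifies the
constant with `κ`. The determinant expansion follows by Taylor's formula, as the off-diagonal
entries are exponentially small.

As `α → 1` absolute convergence is lost. At `b = 1` the differences `Λ_n(1) - Λ_{n+1}(1)` still have
a limit, because the pole of `Γ(1 - 2s)` is compensated; for `b < 1`, integration by parts against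
Lommel's primitive of `t J_n(bt) J_n(t)` restores absolute convergence.
-/

namespace VState

open scoped Nat Real

/-! ### Bessel functions -/

lemma add_one_mul_pow_le_one_add_pow {r : ℝ} (hr : 0 ≤ r) (k : ℕ) :
    (k + 1) * r ^ k ≤ (1 + r) ^ (k + 1) := by
  induction k with
  | zero => simpa using hr
  | succ k ih =>
    have h : r ^ (k + 1) ≤ (1 + r) ^ (k + 1) := by gcongr; linarith
    calc ((k + 1 : ℕ) + 1) * r ^ (k + 1) = r ^ (k + 1) + r * ((k + 1) * r ^ k) := by push_cast; ring
      _ ≤ (1 + r) ^ (k + 1) + r * (1 + r) ^ (k + 1) := by gcongr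
      _ = (1 + r) ^ (k + 1 + 1) := by ring

lemma hasDerivAt_tsum_mul_pow {a : ℕ → ℝ} (ha : ∀ x, Summable fun k => a k * x ^ k) (x : ℝ) :
    HasDerivAt (fun y => ∑' k, a k * y ^ k) (∑' k : ℕ, (k + 1) * a (k + 1) * x ^ k) x := by
  set R := |x| + 1
  have hR : 0 < R := by positivity
  have bound_summable : Summable fun k : ℕ => |a k| * (k * R ^ (k - 1)) := by
    refine (summable_nat_add_iff 1).1 (Summable.of_nonneg_of_le (fun k => by positivity)
      (fun k => ?_) ((summable_nat_add_iff 1).2 (ha (1 + R)).abs))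
    rw [abs_mul, abs_of_nonneg (by positivity : 0 ≤ (1 + R) ^ (k + 1))]
    gcongr
    simpa using add_one_mul_pow_le_one_add_pow hR.le k
  have term_le : ∀ (k : ℕ) (z : ℝ), |z| ≤ R →
      ‖a k * (k * z ^ (k - 1))‖ ≤ |a k| * (k * R ^ (k - 1)) := fun k z hz => by
    rw [Real.norm_eq_abs, abs_mul, abs_mul, abs_pow, Nat.abs_cast]
    gcongr
  have deriv_summable : Summable fun k : ℕ => a k * (k * x ^ (k - 1)) :=
    Summable.of_norm_bounded bound_summable fun k => term_le k x (by simp [R])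
  refine (hasDerivAt_tsum_of_isPreconnected bound_summable Metric.isOpen_ball
    (convex_ball (0 : ℝ) R).isPreconnected (fun k z _ => (hasDerivAt_pow k z).const_mul (a k))
    (fun k z hz => term_le k z (by simpa using (Metric.mem_ball.1 hz).le))
    (Metric.mem_ball_self hR) (ha 0) (by simp [R])).congr_deriv ?_
  rw [deriv_summable.tsum_eq_zero_add]
  simp only [Nat.cast_zero, zero_mul, mul_zero, zero_add]
  exact tsum_congr fun k => by push_cast; ring

/-- The Taylor coefficients of the entire function `besselSeries n`. -/
noncomputable def besselCoeff (n k : ℕ) : ℝ := (-1) ^ k / (k ! * (n + k)!)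

/-- The entire function `y ↦ ∑ (-1)^k y^k / (k! (n+k)!)`, so that `J_n(x) = (x/2)^n G_n(x²/4)`
for `G_n = besselSeries n`. -/
noncomputable def besselSeries (n : ℕ) (y : ℝ) : ℝ := ∑' k, besselCoeff n k * y ^ k

lemma abs_besselCoeff_le (n k : ℕ) : |besselCoeff n k| ≤ 1 / k ! := by
  have h : (1 : ℝ) ≤ (n + k)! := mod_cast Nat.succ_le_of_lt (Nat.factorial_pos _)
  rw [besselCoeff, abs_div, abs_pow, abs_neg, abs_one, one_pow, abs_of_pos (by positivity)]
  exact one_div_le_one_div_of_le (by positivity) (le_mul_of_one_le_right (by positivity) h)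

lemma besselCoeff_succ_left (n k : ℕ) :
    (n + k + 1) * besselCoeff (n + 1) k = besselCoeff n k := by
  rw [besselCoeff, besselCoeff, show n + 1 + k = n + k + 1 by ring, Nat.factorial_succ]
  push_cast
  field_simp

lemma besselCoeff_succ_right (n k : ℕ) :
    (k + 1) * besselCoeff n (k + 1) = -besselCoeff (n + 1) k := by
  rw [besselCoeff, besselCoeff, show n + 1 + k = n + (k + 1) by ring, Nat.factorial_succ k]
  push_cast
  field_simp
  ring

lemma summable_besselCoeff_mul_pow (n : ℕ) (y : ℝ) :
    Summable fun k => besselCoeff n k * y ^ k := by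
  refine Summable.of_norm_bounded (Real.summable_pow_div_factorial |y|) fun k => ?_
  rw [Real.norm_eq_abs, abs_mul, abs_pow, div_eq_mul_one_div, mul_comm (|y| ^ k)]
  exact mul_le_mul_of_nonneg_right (abs_besselCoeff_le n k) (by positivity)

lemma hasDerivAt_besselSeries (n : ℕ) (y : ℝ) :
    HasDerivAt (besselSeries n) (-besselSeries (n + 1) y) y := by
  refine (hasDerivAt_tsum_mul_pow (summable_besselCoeff_mul_pow n) y).congr_deriv ?_
  simp only [besselCoeff_succ_right, besselSeries, neg_mul, tsum_neg]

lemma besselSeries_recurrence (n : ℕ) (y : ℝ) :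
    (n + 1) * besselSeries (n + 1) y = besselSeries n y + y * besselSeries (n + 2) y := by
  have hn := summable_besselCoeff_mul_pow n y
  have hn1 := (summable_besselCoeff_mul_pow (n + 1) y).mul_left ((n : ℝ) + 1)
  have hn2 := (summable_besselCoeff_mul_pow (n + 2) y).mul_left y
  simp only [besselSeries, ← tsum_mul_left]
  rw [hn1.tsum_eq_zero_add, hn.tsum_eq_zero_add, add_assoc,
    ← Summable.tsum_add ((summable_nat_add_iff 1).2 hn) hn2]
  congr 1
  · rw [← besselCoeff_succ_left n 0]; push_cast; ring
  · refine tsum_congr fun k => ?_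
    have h1 := besselCoeff_succ_left n (k + 1)
    have h2 := besselCoeff_succ_right (n + 1) k
    push_cast at h1
    linear_combination y ^ (k + 1) * h1 - y ^ (k + 1) * h2

@[fun_prop]
lemma continuous_besselSeries (n : ℕ) : Continuous (besselSeries n) :=
  continuous_iff_continuousAt.2 fun y => (hasDerivAt_besselSeries n y).continuousAt

lemma besselJ_eq (n : ℕ) : besselJ n = fun x => (x / 2) ^ n * besselSeries n ((x / 2) ^ 2) := by
  funext x
  rw [besselJ, besselSeries, ← tsum_mul_left]
  exact tsum_congr fun k => by rw [besselCoeff, pow_add, pow_mul]; ring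

@[fun_prop]
lemma continuous_besselJ (n : ℕ) : Continuous (besselJ n) := by
  rw [besselJ_eq]
  fun_prop

lemma hasDerivAt_besselJ (n : ℕ) {x : ℝ} (hx : x ≠ 0) :
    HasDerivAt (besselJ n) (n / x * besselJ n x - besselJ (n + 1) x) x := by
  simp only [besselJ_eq]
  have half : HasDerivAt (fun x : ℝ => x / 2) (1 / 2) x := (hasDerivAt_id x).div_const 2
  refine ((half.pow n).mul
    ((hasDerivAt_besselSeries n ((x / 2) ^ 2)).comp x (half.pow 2))).congr_deriv ?_
  simp only [Pi.pow_apply, Function.comp]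
  rcases n with _ | n
  · simp; ring
  · simp only [Nat.add_sub_cancel]
    push_cast
    field_simp
    ring

lemma hasDerivAt_besselJ_succ (n : ℕ) {x : ℝ} (hx : x ≠ 0) :
    HasDerivAt (besselJ (n + 1)) (besselJ n x - (n + 1) / x * besselJ (n + 1) x) x := by
  refine (hasDerivAt_besselJ (n + 1) hx).congr_deriv ?_
  have hrec : besselSeries n ((x / 2) ^ 2) = (n + 1) * besselSeries (n + 1) ((x / 2) ^ 2)
      - (x / 2) ^ 2 * besselSeries (n + 2) ((x / 2) ^ 2) := by
    linarith [besselSeries_recurrence n ((x / 2) ^ 2)]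
  simp only [besselJ_eq, hrec]
  push_cast
  field_simp
  ring

/-- A modified energy of the first-order system satisfied by `(J_n, J_{n+1})`. The cross term
makes its derivative `O(1/x²)` relative to the energy itself. -/
noncomputable def besselEnergy (n : ℕ) (x : ℝ) : ℝ :=
  x * (besselJ n x ^ 2 + besselJ (n + 1) x ^ 2) - (2 * n + 1) * (besselJ n x * besselJ (n + 1) x)

lemma hasDerivAt_besselEnergy (n : ℕ) {x : ℝ} (hx : x ≠ 0) :
    HasDerivAt (besselEnergy n) ((2 * n + 1) * (besselJ n x * besselJ (n + 1) x) / x) x := by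
  have hn := hasDerivAt_besselJ n hx
  have hn1 := hasDerivAt_besselJ_succ n hx
  refine (((hasDerivAt_id x).mul ((hn.pow 2).add (hn1.pow 2))).sub
    ((hn.mul hn1).const_mul (2 * n + 1 : ℝ))).congr_deriv ?_
  simp only [id, Pi.add_apply, Pi.pow_apply]
  push_cast
  field_simp
  ring

lemma mul_sq_add_sq_besselJ_le_two_mul_besselEnergy {n : ℕ} {x : ℝ} (hx : 2 * n + 1 ≤ x) :
    x * (besselJ n x ^ 2 + besselJ (n + 1) x ^ 2) ≤ 2 * besselEnergy n x := by
  have hN : (0 : ℝ) ≤ 2 * n + 1 := by positivity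
  rw [besselEnergy]
  nlinarith [mul_nonneg hN (sq_nonneg (besselJ n x - besselJ (n + 1) x)),
    mul_nonneg (sub_nonneg.2 hx) (add_nonneg (sq_nonneg (besselJ n x))
      (sq_nonneg (besselJ (n + 1) x)))]

lemma antitoneOn_besselEnergy_mul_exp (n : ℕ) :
    AntitoneOn (fun x => besselEnergy n x * Real.exp ((2 * n + 1) / x)) (Ici (2 * n + 1)) := by
  set N : ℝ := 2 * n + 1 with hN
  have hN0 : 0 < N := by positivity
  have hderiv : ∀ x, N ≤ x → HasDerivAt (fun x => besselEnergy n x * Real.exp (N / x))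
      (-(N * Real.exp (N / x) / x ^ 2 *
        (besselEnergy n x - x * (besselJ n x * besselJ (n + 1) x)))) x := fun x hx => by
    have hx0 : x ≠ 0 := (hN0.trans_le hx).ne'
    refine ((hasDerivAt_besselEnergy n hx0).mul
      ((hasDerivAt_const x N).div (hasDerivAt_id x) hx0).exp).congr_deriv ?_
    simp only [id, Pi.div_apply, ← hN]
    field_simp
    ring
  refine antitoneOn_of_deriv_nonpos (convex_Ici N)
    (fun x hx => (hderiv x hx).continuousAt.continuousWithinAt)
    (fun x hx => (hderiv x (interior_subset hx)).differentiableAt.differentiableWithinAt)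
    (fun x hx => ?_)
  have hNx : N ≤ x := interior_subset hx
  have hx0 : 0 < x := hN0.trans_le hNx
  rw [(hderiv x hNx).deriv, neg_nonpos]
  refine mul_nonneg (by positivity) ?_
  nlinarith [mul_sq_add_sq_besselJ_le_two_mul_besselEnergy hNx,
    mul_nonneg hx0.le (sq_nonneg (besselJ n x - besselJ (n + 1) x))]

lemma exists_mul_sq_add_sq_besselJ_le (n : ℕ) :
    ∃ C : ℝ, ∀ x, 0 ≤ x → x * (besselJ n x ^ 2 + besselJ (n + 1) x ^ 2) ≤ C := by
  set N : ℝ := 2 * n + 1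
  have : 0 < N := by positivity
  obtain ⟨C, hC⟩ := (isCompact_Icc (a := (0 : ℝ)) (b := N)).exists_bound_of_continuousOn
    (f := fun x => x * (besselJ n x ^ 2 + besselJ (n + 1) x ^ 2))
    (by fun_prop : Continuous _).continuousOn
  refine ⟨max C (2 * (besselEnergy n N * Real.exp (N / N))), fun x hx => ?_⟩
  rcases le_total x N with h | h
  · exact (le_abs_self _).trans ((hC x ⟨hx, h⟩).trans (le_max_left _ _))
  have hle := mul_sq_add_sq_besselJ_le_two_mul_besselEnergy h
  have hnonneg : 0 ≤ x * (besselJ n x ^ 2 + besselJ (n + 1) x ^ 2) := by positivity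
  refine le_max_of_le_right ?_
  calc x * (besselJ n x ^ 2 + besselJ (n + 1) x ^ 2) ≤ 2 * besselEnergy n x := hle
    _ ≤ 2 * (besselEnergy n x * Real.exp (N / x)) := by
      gcongr
      exact le_mul_of_one_le_right (by linarith) (Real.one_le_exp (by positivity))
    _ ≤ 2 * (besselEnergy n N * Real.exp (N / N)) := by
      exact mul_le_mul_of_nonneg_left (antitoneOn_besselEnergy_mul_exp n self_mem_Ici h h)
        zero_le_two

lemma exists_abs_besselJ_le_div_sqrt (n : ℕ) :
    ∃ C : ℝ, 0 < C ∧ ∀ x, 0 < x → |besselJ n x| ≤ C / √x := by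
  obtain ⟨C, hC⟩ := exists_mul_sq_add_sq_besselJ_le n
  refine ⟨√(|C| + 1), by positivity, fun x hx => ?_⟩
  rw [← Real.sqrt_div (by positivity)]
  refine Real.abs_le_sqrt ((le_div_iff₀ hx).2 ?_)
  nlinarith [hC x hx.le, le_abs_self C, mul_nonneg hx.le (sq_nonneg (besselJ (n + 1) x))]

lemma exists_abs_besselJ_le (n : ℕ) : ∃ C : ℝ, 0 < C ∧ ∀ x, 0 ≤ x → |besselJ n x| ≤ C := by
  obtain ⟨C, hC0, hC⟩ := exists_abs_besselJ_le_div_sqrt n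
  obtain ⟨D, hD⟩ := (isCompact_Icc (a := (0 : ℝ)) (b := 1)).exists_bound_of_continuousOn
    (continuous_besselJ n).continuousOn
  refine ⟨max C D, lt_max_of_lt_left hC0, fun x hx => ?_⟩
  rcases le_total x 1 with h | h
  · exact (hD x ⟨hx, h⟩).trans (le_max_right _ _)
  · exact (hC x (one_pos.trans_le h)).trans
      (le_max_of_le_left (div_le_self hC0.le (Real.one_le_sqrt.2 h)))

lemma exists_abs_besselJ_succ_le_mul (n : ℕ) :
    ∃ C : ℝ, 0 < C ∧ ∀ x, 0 ≤ x → |besselJ (n + 1) x| ≤ C * x := by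
  obtain ⟨C, hC0, hC⟩ := exists_abs_besselJ_le (n + 1)
  obtain ⟨D, hD⟩ := (isCompact_Icc (a := (0 : ℝ)) (b := 1)).exists_bound_of_continuousOn
    (f := fun x : ℝ => 1 / 2 * (x / 2) ^ n * besselSeries (n + 1) ((x / 2) ^ 2))
    (by fun_prop : Continuous _).continuousOn
  refine ⟨max C D, lt_max_of_lt_left hC0, fun x hx => ?_⟩
  rcases le_total x 1 with h | h
  · calc |besselJ (n + 1) x|
        = |1 / 2 * (x / 2) ^ n * besselSeries (n + 1) ((x / 2) ^ 2)| * x := by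
          rw [← abs_of_nonneg hx, ← abs_mul, abs_of_nonneg hx, besselJ_eq]
          ring_nf
      _ ≤ max C D * x := by gcongr; exact (hD x ⟨hx, h⟩).trans (le_max_right _ _)
  · calc |besselJ (n + 1) x| ≤ C := hC x hx
      _ ≤ max C D := le_max_left _ _
      _ ≤ max C D * x := le_mul_of_one_le_right (hC0.le.trans (le_max_left _ _)) h

/-! ### Absolute convergence -/

/-- The majorant equal to `t ^ p` for `t ≤ 1` and to `t ^ q` for `t > 1`. -/
noncomputable def gluedRpow (p q t : ℝ) : ℝ := if t ≤ 1 then t ^ p else t ^ q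

lemma integrableOn_gluedRpow {p q : ℝ} (hp : -1 < p) (hq : q < -1) :
    IntegrableOn (gluedRpow p q) (Ioi 0) := by
  rw [← Ioc_union_Ioi_eq_Ioi (zero_le_one (α := ℝ))]
  refine IntegrableOn.union ?_ ?_
  · refine (intervalIntegral.intervalIntegrable_rpow' (a := 0) (b := 1) hp).1.congr_fun
      (fun t ht => ?_) measurableSet_Ioc
    rw [gluedRpow, if_pos ht.2]
  · refine (integrableOn_Ioi_rpow_of_lt hq one_pos).congr_fun (fun t ht => ?_) measurableSet_Ioi
    rw [gluedRpow, if_neg (not_le.2 ht)]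

lemma continuousOn_lambdaIntegrand (α : ℝ) (n : ℕ) (b : ℝ) :
    ContinuousOn (lambdaIntegrand α n b) (Ioi 0) := by
  refine ContinuousOn.div (by fun_prop) ?_ fun t ht => (Real.rpow_pos_of_pos ht _).ne'
  exact continuousOn_id.rpow_const fun t ht => Or.inl (ne_of_gt ht)

lemma exists_abs_mul_besselJ_le (m n : ℕ) : ∃ C : ℝ, 0 < C ∧ ∀ b t : ℝ, 0 < b → 0 < t →
    |besselJ m (b * t) * besselJ n t| ≤ C / (√b * t) := by
  obtain ⟨C, hC0, hC⟩ := exists_abs_besselJ_le_div_sqrt m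
  obtain ⟨D, hD0, hD⟩ := exists_abs_besselJ_le_div_sqrt n
  refine ⟨C * D, by positivity, fun b t hb ht => ?_⟩
  calc |besselJ m (b * t) * besselJ n t| ≤ C / √(b * t) * (D / √t) := by
        rw [abs_mul]
        gcongr
        exacts [hC _ (mul_pos hb ht), hD t ht]
    _ = C * D / (√b * t) := by
        rw [div_mul_div_comm, Real.sqrt_mul hb.le, mul_assoc, Real.mul_self_sqrt ht.le]

lemma exists_abs_lambdaIntegrand_le (n : ℕ) {c : ℝ} (hc : 0 < c) : ∃ C : ℝ,
    ∀ α b t : ℝ, c ≤ b → 0 < t → |lambdaIntegrand α n b t| ≤ C * gluedRpow (α - 1) (α - 2) t := by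
  obtain ⟨C, hC0, hC⟩ := exists_abs_besselJ_le n
  obtain ⟨D, hD0, hD⟩ := exists_abs_mul_besselJ_le n n
  refine ⟨max (C * C) (D / √c), fun α b t hb ht => ?_⟩
  have hb0 := hc.trans_le hb
  have hr : 0 < t ^ (1 - α) := Real.rpow_pos_of_pos ht _
  rw [lambdaIntegrand, abs_div, abs_of_pos hr, gluedRpow]
  split_ifs with h
  · rw [show α - 1 = -(1 - α) by ring, Real.rpow_neg ht.le, ← div_eq_mul_inv]
    gcongr
    refine le_max_of_le_left ?_
    rw [abs_mul]
    exact mul_le_mul (hC _ (by positivity)) (hC _ ht.le) (abs_nonneg _) hC0.le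
  · have hpow : t ^ (α - 2) = t⁻¹ / t ^ (1 - α) := by
      rw [show α - 2 = -1 - (1 - α) by ring, Real.rpow_sub ht, Real.rpow_neg_one]
    rw [hpow, ← mul_div_assoc]
    gcongr
    calc |besselJ n (b * t) * besselJ n t| ≤ D / (√b * t) := hD b t hb0 ht
      _ ≤ D / (√c * t) := by gcongr
      _ = D / √c * t⁻¹ := by rw [← div_div, ← div_eq_mul_inv]
      _ ≤ max (C * C) (D / √c) * t⁻¹ := by gcongr; exact le_max_right _ _

lemma integrableOn_lambdaIntegrand {α : ℝ} (hα : α ∈ Ioo (0 : ℝ) 1) (n : ℕ) {b : ℝ} (hb : 0 < b) :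
    IntegrableOn (lambdaIntegrand α n b) (Ioi 0) := by
  obtain ⟨C, hC⟩ := exists_abs_lambdaIntegrand_le n hb
  refine Integrable.mono' ((integrableOn_gluedRpow (p := α - 1) (q := α - 2) (by linarith [hα.1])
    (by linarith [hα.2])).const_mul C)
    ((continuousOn_lambdaIntegrand α n b).aestronglyMeasurable measurableSet_Ioi) ?_
  filter_upwards [ae_restrict_mem measurableSet_Ioi] with t ht
  exact hC α b t le_rfl ht

lemma continuousAt_integral_lambdaIntegrand {α : ℝ} (hα : α ∈ Ioo (0 : ℝ) 1) (n : ℕ) {b : ℝ}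
    (hb : 0 < b) : ContinuousAt (fun β => ∫ t in Ioi (0 : ℝ), lambdaIntegrand α n β t) b := by
  obtain ⟨C, hC⟩ := exists_abs_lambdaIntegrand_le n (half_pos hb)
  refine tendsto_integral_filter_of_dominated_convergence
    (fun t => C * gluedRpow (α - 1) (α - 2) t) ?_ ?_ ?_ ?_
  · exact Eventually.of_forall fun β =>
      (continuousOn_lambdaIntegrand α n β).aestronglyMeasurable measurableSet_Ioi
  · filter_upwards [Ici_mem_nhds (half_lt_self hb)] with β hβ
    filter_upwards [ae_restrict_mem measurableSet_Ioi] with t ht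
    exact hC α β t hβ ht
  · exact (integrableOn_gluedRpow (by linarith [hα.1]) (by linarith [hα.2])).const_mul C
  · refine Eventually.of_forall fun t => ?_
    exact (by unfold lambdaIntegrand; fun_prop :
      Continuous fun β => lambdaIntegrand α n β t).tendsto b

/-! ### The addition theorem -/

lemma hasSum_mul_prod {𝕜 ι κ : Type*} [RCLike 𝕜] {f : ι → 𝕜} {g : κ → 𝕜} {a b : 𝕜}
    (hf : HasSum f a) (hg : HasSum g b) : HasSum (fun q : ι × κ => f q.1 * g q.2) (a * b) :=
  hf.mul hg (summable_mul_of_summable_norm hf.summable.norm hg.summable.norm)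

lemma integral_cos_int_mul (m : ℤ) :
    ∫ θ in (0 : ℝ)..2 * π, Real.cos (m * θ) = if m = 0 then 2 * π else 0 := by
  split_ifs with h
  · simp [h]
  · have hm : (m : ℝ) ≠ 0 := Int.cast_ne_zero.2 h
    rw [intervalIntegral.integral_comp_mul_left _ hm, integral_cos,
      show (m : ℝ) * (2 * π) = (2 * m : ℤ) * π by push_cast; ring, Real.sin_int_mul_pi]
    simp

lemma hasSum_norm_sq_mul_cos {a : ℕ → ℝ} {θ : ℝ} {w : ℂ}
    (hw : HasSum (fun k => (a k : ℂ) * Complex.exp (θ * Complex.I) ^ k) w) (n : ℕ) :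
    HasSum (fun q : ℕ × ℕ => a q.1 * a q.2 * Real.cos (((q.1 : ℤ) - q.2 - n : ℤ) * θ))
      (‖w‖ ^ 2 * Real.cos (n * θ)) := by
  have hconj : HasSum (fun k => (a k : ℂ) * Complex.exp ((-θ : ℝ) * Complex.I) ^ k)
      (starRingEnd ℂ w) := by
    simpa [← Complex.exp_conj] using Complex.hasSum_conj'.2 hw
  have hre := Complex.hasSum_re
    ((hasSum_mul_prod hw hconj).mul_right (Complex.exp ((-(n * θ) : ℝ) * Complex.I)))
  rw [Complex.mul_conj, Complex.re_ofReal_mul, Complex.exp_ofReal_mul_I_re, Real.cos_neg,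
    Complex.normSq_eq_norm_sq] at hre
  refine hre.congr_fun fun q => ?_
  have hexp : Complex.exp (θ * Complex.I) ^ q.1 * Complex.exp ((-θ : ℝ) * Complex.I) ^ q.2 *
      Complex.exp ((-(n * θ) : ℝ) * Complex.I) =
      Complex.exp (((((q.1 : ℤ) - q.2 - n : ℤ) : ℝ) * θ : ℝ) * Complex.I) := by
    rw [← Complex.exp_nat_mul, ← Complex.exp_nat_mul, ← Complex.exp_add, ← Complex.exp_add]
    congr 1
    push_cast
    ring
  rw [mul_mul_mul_comm, mul_assoc (_ * _ : ℂ), hexp, ← Complex.ofReal_mul, Complex.re_ofReal_mul,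
    Complex.exp_ofReal_mul_I_re]

lemma hasSum_integral_norm_sq_mul_cos {a : ℕ → ℝ} (ha : Summable a) {f : ℂ → ℂ}
    (hf : ∀ z : ℂ, ‖z‖ = 1 → HasSum (fun k => (a k : ℂ) * z ^ k) (f z)) (n : ℕ) :
    HasSum (fun k => 2 * π * (a (n + k) * a k))
      (∫ θ in (0 : ℝ)..2 * π, ‖f (Complex.exp (θ * Complex.I))‖ ^ 2 * Real.cos (n * θ)) := by
  have hdouble := intervalIntegral.hasSum_integral_of_dominated_convergence
    (μ := volume) (a := 0) (b := 2 * π)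
    (F := fun (q : ℕ × ℕ) θ => a q.1 * a q.2 * Real.cos (((q.1 : ℤ) - q.2 - n : ℤ) * θ))
    (fun q _ => |a q.1 * a q.2|)
    (fun q => (by fun_prop : Continuous _).aestronglyMeasurable)
    (fun q => Eventually.of_forall fun θ _ => by
      rw [norm_mul, Real.norm_eq_abs, Real.norm_eq_abs]
      exact mul_le_of_le_one_right (abs_nonneg _) (Real.abs_cos_le_one _))
    (Eventually.of_forall fun _ _ => (hasSum_mul_prod ha.hasSum ha.hasSum).summable.abs)
    intervalIntegrable_const
    (Eventually.of_forall fun θ _ =>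
      hasSum_norm_sq_mul_cos (hf _ (Complex.norm_exp_ofReal_mul_I θ)) n)
  have hterm : ∀ q : ℕ × ℕ, ∫ θ in (0 : ℝ)..2 * π,
      a q.1 * a q.2 * Real.cos (((q.1 : ℤ) - q.2 - n : ℤ) * θ) =
        if q.1 = n + q.2 then 2 * π * (a q.1 * a q.2) else 0 := fun q => by
    have hiff : (q.1 : ℤ) - q.2 - n = 0 ↔ q.1 = n + q.2 := by omega
    simp only [intervalIntegral.integral_const_mul, integral_cos_int_mul, hiff]
    split_ifs <;> ring
  have hinj : Function.Injective fun k : ℕ => (n + k, k) := fun k l h => (Prod.mk.inj h).2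
  simp only [hterm] at hdouble
  rw [← hinj.hasSum_iff] at hdouble
  · simpa [Function.comp_def] using hdouble
  · rintro ⟨j, k⟩ hq
    exact if_neg fun h : j = n + k => hq ⟨k, by rw [h]⟩

/-- The squared length `|1 - b e^{iθ}|²` of the third side of a triangle with sides `1`, `b`
enclosing the angle `θ`. -/
noncomputable def chordSq (b θ : ℝ) : ℝ := 1 + b ^ 2 - 2 * b * Real.cos θ

@[fun_prop]
lemma continuous_chordSq (b : ℝ) : Continuous (chordSq b) := by unfold chordSq; fun_prop

lemma norm_one_sub_mul_exp_sq (b θ : ℝ) :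
    ‖1 - b * Complex.exp (θ * Complex.I)‖ ^ 2 = chordSq b θ := by
  rw [← Complex.normSq_eq_norm_sq, Complex.normSq_apply]
  simp only [Complex.sub_re, Complex.one_re, Complex.re_ofReal_mul, Complex.exp_ofReal_mul_I_re,
    Complex.sub_im, Complex.one_im, Complex.im_ofReal_mul, Complex.exp_ofReal_mul_I_im, chordSq]
  linear_combination b ^ 2 * Real.sin_sq_add_cos_sq θ

lemma chordSq_nonneg (b θ : ℝ) : 0 ≤ chordSq b θ := by
  rw [← norm_one_sub_mul_exp_sq]; positivity

lemma chordSq_le (b θ : ℝ) : chordSq b θ ≤ (1 + |b|) ^ 2 := by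
  rw [← norm_one_sub_mul_exp_sq]
  gcongr
  refine (norm_sub_le _ _).trans_eq ?_
  simp [Complex.norm_exp_ofReal_mul_I]

lemma sq_one_sub_le_chordSq {b : ℝ} (hb : 0 ≤ b) (θ : ℝ) : (1 - b) ^ 2 ≤ chordSq b θ := by
  rw [chordSq]; nlinarith [Real.cos_le_one θ]

lemma hasSum_choose_mul_pow (m : ℕ) (b : ℝ) (z : ℂ) :
    HasSum (fun k => ((m.choose k * (-b) ^ k : ℝ) : ℂ) * z ^ k) ((1 - b * z) ^ m) := by
  have hzero : ∀ k ∉ Finset.range (m + 1), ((m.choose k * (-b) ^ k : ℝ) : ℂ) * z ^ k = 0 :=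
    fun k hk => by
      rw [Nat.choose_eq_zero_of_lt (by simpa using hk)]
      simp
  have hsum := hasSum_sum_of_ne_finset_zero (L := .unconditional ℕ) hzero
  convert hsum using 1
  rw [show 1 - (b : ℂ) * z = -b * z + 1 by ring, add_pow]
  refine Finset.sum_congr rfl fun k _ => ?_
  push_cast
  rw [mul_pow]
  ring

lemma hasSum_integral_chordSq_pow_mul_cos (b : ℝ) (m n : ℕ) :
    HasSum (fun k => 2 * π * ((-1) ^ n * m.choose (n + k) * m.choose k * b ^ (n + 2 * k)))
      (∫ θ in (0 : ℝ)..2 * π, chordSq b θ ^ m * Real.cos (n * θ)) := by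
  have hsummable : Summable fun k => (m.choose k * (-b) ^ k : ℝ) := by
    refine summable_of_ne_finset_zero (s := Finset.range (m + 1)) fun k hk => ?_
    rw [Nat.choose_eq_zero_of_lt (by simpa using hk), Nat.cast_zero, zero_mul]
  have h := hasSum_integral_norm_sq_mul_cos hsummable
    (fun z _ => hasSum_choose_mul_pow m b z) n
  simp only [norm_pow, ← pow_mul, mul_comm m 2] at h
  simp only [pow_mul, norm_one_sub_mul_exp_sq] at h
  refine h.congr_fun fun k => ?_
  have hsign : (-b) ^ (n + k) * (-b) ^ k = (-1) ^ n * b ^ (n + 2 * k) := by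
    rw [← pow_add, show n + k + k = n + 2 * k by ring, neg_pow, pow_add, pow_mul]
    simp
  linear_combination 2 * π * m.choose (n + k) * m.choose k * (-hsign)

lemma hasSum_besselJ (n : ℕ) (x : ℝ) :
    HasSum (fun k => besselCoeff n k * (x / 2) ^ (2 * k + n)) (besselJ n x) := by
  refine Summable.hasSum (((summable_besselCoeff_mul_pow n ((x / 2) ^ 2)).mul_right
    ((x / 2) ^ n)).congr fun k => ?_)
  rw [pow_add, pow_mul]
  ring

lemma hasSum_besselJ_zero_sqrt_mul {y : ℝ} (hy : 0 ≤ y) (t : ℝ) :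
    HasSum (fun m => besselCoeff 0 m * (t / 2) ^ (2 * m) * y ^ m) (besselJ 0 (√y * t)) := by
  refine (hasSum_besselJ 0 (√y * t)).congr_fun fun m => ?_
  rw [add_zero, mul_div_assoc, mul_pow (√y), pow_mul √y, Real.sq_sqrt hy]
  ring

lemma hasSum_integral_besselJ_zero_mul_cos (n : ℕ) (b t : ℝ) :
    HasSum (fun m => besselCoeff 0 m * (t / 2) ^ (2 * m) *
        ∫ θ in (0 : ℝ)..2 * π, chordSq b θ ^ m * Real.cos (n * θ))
      (∫ θ in (0 : ℝ)..2 * π, besselJ 0 (√(chordSq b θ) * t) * Real.cos (n * θ)) := by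
  simp only [← intervalIntegral.integral_const_mul, ← mul_assoc]
  refine intervalIntegral.hasSum_integral_of_dominated_convergence
    (fun m _ => ‖besselCoeff 0 m * ((t / 2) ^ 2 * (1 + |b|) ^ 2) ^ m‖)
    (fun m => (by fun_prop : Continuous _).aestronglyMeasurable)
    (fun m => Eventually.of_forall fun θ _ => ?_)
    (Eventually.of_forall fun _ _ => (summable_besselCoeff_mul_pow 0 _).norm)
    intervalIntegrable_const
    (Eventually.of_forall fun θ _ =>
      (hasSum_besselJ_zero_sqrt_mul (chordSq_nonneg b θ) t).mul_right _)
  rw [mul_pow, ← pow_mul, ← mul_assoc, norm_mul, norm_mul, norm_mul _ (((1 + |b|) ^ 2) ^ m)]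
  have hcos : ‖Real.cos (n * θ)‖ ≤ 1 := Real.abs_cos_le_one _
  have hpow : ‖chordSq b θ ^ m‖ ≤ ‖((1 + |b|) ^ 2) ^ m‖ := by
    rw [norm_pow, norm_pow, Real.norm_of_nonneg (chordSq_nonneg b θ),
      Real.norm_of_nonneg (by positivity)]
    exact pow_le_pow_left₀ (chordSq_nonneg b θ) (chordSq_le b θ) m
  exact (mul_le_of_le_one_right (by positivity) hcos).trans (by gcongr)

lemma besselCoeff_zero_mul_choose_mul_choose (n k j : ℕ) :
    besselCoeff 0 (n + k + j) * ((-1) ^ n * (n + k + j).choose (n + k) * (n + k + j).choose k) =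
      besselCoeff n j * besselCoeff n k := by
  have hsign : (-1 : ℝ) ^ (n + k + j) * (-1) ^ n = (-1) ^ j * (-1) ^ k := by
    rw [show n + k + j = n + (j + k) by ring, pow_add, pow_add, mul_right_comm, ← mul_pow]
    simp
  have hk : (n + k + j).choose k = (k + (n + j)).choose k := by congr 1; ring
  have hfac : n + k + j = k + (n + j) := by ring
  simp only [besselCoeff, hk, Nat.cast_add_choose, zero_add, ← hfac]
  field_simp
  linear_combination hsign

lemma hasSum_besselJ_mul_besselJ (n : ℕ) (b t : ℝ) :
    HasSum (fun q : ℕ × ℕ => besselCoeff 0 q.1 * (t / 2) ^ (2 * q.1) *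
        ((-1) ^ n * q.1.choose (n + q.2) * q.1.choose q.2 * b ^ (n + 2 * q.2)))
      (besselJ n (b * t) * besselJ n t) := by
  have hinj : Function.Injective fun q : ℕ × ℕ => (n + q.1 + q.2, q.1) := by
    rintro ⟨k, j⟩ ⟨k', j'⟩ h
    simp only [Prod.mk.injEq] at h ⊢
    omega
  rw [← hinj.hasSum_iff]
  · refine (hasSum_mul_prod (hasSum_besselJ n (b * t)) (hasSum_besselJ n t)).congr_fun ?_
    rintro ⟨k, j⟩
    simp only [Function.comp]
    rw [mul_div_assoc, mul_pow b]
    linear_combination (t / 2) ^ (2 * (n + k + j)) * b ^ (n + 2 * k) *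
      besselCoeff_zero_mul_choose_mul_choose n k j
  · rintro ⟨m, k⟩ hq
    have hlt : m < n + k := by
      by_contra! hle
      exact hq ⟨(k, m - (n + k)), by simp [Nat.add_sub_cancel' hle]⟩
    simp [Nat.choose_eq_zero_of_lt hlt]

-- Both sides are power series in `t` and `b`: the coefficient of `t^{2m} b^{n+2k}` on the right is
-- a multiple of `C(m, n+k) C(m, k) / m!²`, which splits into a product of two Bessel coefficients.
theorem two_pi_mul_besselJ_mul_besselJ (n : ℕ) (b t : ℝ) :
    2 * π * (besselJ n (b * t) * besselJ n t) =
      ∫ θ in (0 : ℝ)..2 * π, besselJ 0 (√(chordSq b θ) * t) * Real.cos (n * θ) := by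
  have hfiber : HasSum (fun m => besselCoeff 0 m * (t / 2) ^ (2 * m) *
      ∫ θ in (0 : ℝ)..2 * π, chordSq b θ ^ m * Real.cos (n * θ))
      (2 * π * (besselJ n (b * t) * besselJ n t)) := by
    refine ((hasSum_besselJ_mul_besselJ n b t).mul_left (2 * π)).prod_fiberwise fun m => ?_
    refine ((hasSum_integral_chordSq_pow_mul_cos b m n).mul_left _).congr_fun fun k => ?_
    ring
  exact hfiber.unique (hasSum_integral_besselJ_zero_mul_cos n b t)

/-! ### Gaussian superposition -/

lemma integral_pow_mul_exp_neg_sq_div {u : ℝ} (hu : 0 < u) (m : ℕ) :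
    ∫ t in Ioi (0 : ℝ), t ^ (2 * m + 1) * Real.exp (-(t ^ 2 / (4 * u))) =
      m ! * (4 * u) ^ (m + 1) / 2 := by
  have h := integral_rpow_mul_exp_neg_mul_rpow (p := 2) (q := (2 * m + 1 : ℕ)) (b := (4 * u)⁻¹)
    two_pos (by linarith [(2 * m + 1).cast_nonneg (α := ℝ)]) (by positivity)
  simp only [Real.rpow_natCast, Real.rpow_ofNat, neg_mul, inv_mul_eq_div] at h
  have hexponent : -((2 * m + 1 : ℕ) + 1 : ℝ) / 2 = -(m + 1 : ℕ) := by push_cast; ring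
  have hgamma : ((2 * m + 1 : ℕ) + 1 : ℝ) / 2 = m + 1 := by push_cast; ring
  rw [h, hexponent, hgamma, Real.Gamma_nat_eq_factorial, Real.rpow_neg (by positivity),
    Real.rpow_natCast, inv_pow, inv_inv]
  ring

lemma integrableOn_pow_mul_exp_neg_sq_div {u : ℝ} (hu : 0 < u) (m : ℕ) :
    IntegrableOn (fun t => t ^ (2 * m + 1) * Real.exp (-(t ^ 2 / (4 * u)))) (Ioi (0 : ℝ)) := by
  refine not_imp_comm.1 integral_undef ?_
  rw [integral_pow_mul_exp_neg_sq_div hu]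
  positivity

lemma integral_mul_exp_mul_besselJ_zero {u : ℝ} (hu : 0 < u) (ρ : ℝ) :
    ∫ t in Ioi (0 : ℝ), t * Real.exp (-(t ^ 2 / (4 * u))) * besselJ 0 (ρ * t) =
      2 * u * Real.exp (-(ρ ^ 2 * u)) := by
  have hexp (x : ℝ) : HasSum (fun m : ℕ => x ^ m / m !) (Real.exp x) := by
    rw [Real.exp_eq_exp_ℝ]
    exact NormedSpace.expSeries_div_hasSum_exp x
  set F : ℕ → ℝ → ℝ := fun m t => besselCoeff 0 m * (ρ / 2) ^ (2 * m) *
    (t ^ (2 * m + 1) * Real.exp (-(t ^ 2 / (4 * u)))) with hF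
  have hF_int (m : ℕ) : IntegrableOn (F m) (Ioi 0) :=
    (integrableOn_pow_mul_exp_neg_sq_div hu m).const_mul _
  have hF_integral (m : ℕ) : ∫ t in Ioi 0, F m t = 2 * u * ((-(ρ ^ 2 * u)) ^ m / m !) := by
    have hscale : (ρ ^ 2 * u) ^ m = (ρ / 2) ^ (2 * m) * (4 * u) ^ m := by
      rw [pow_mul, ← mul_pow]; ring
    rw [integral_const_mul, integral_pow_mul_exp_neg_sq_div hu, besselCoeff, zero_add,
      neg_pow (ρ ^ 2 * u), hscale, pow_succ (4 * u)]
    field_simp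
    ring
  have hF_norm (m : ℕ) : ∫ t in Ioi 0, ‖F m t‖ = 2 * u * ((ρ ^ 2 * u) ^ m / m !) := by
    have hkernel : 0 ≤ ∫ t in Ioi (0 : ℝ), t ^ (2 * m + 1) * Real.exp (-(t ^ 2 / (4 * u))) := by
      rw [integral_pow_mul_exp_neg_sq_div hu]; positivity
    have habs : ∫ t in Ioi 0, ‖F m t‖ = |∫ t in Ioi 0, F m t| := by
      rw [integral_const_mul, abs_mul, abs_of_nonneg hkernel, ← integral_const_mul]
      refine setIntegral_congr_fun measurableSet_Ioi fun t ht => ?_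
      have ht' : (0 : ℝ) < t := ht
      rw [norm_mul, Real.norm_eq_abs, Real.norm_of_nonneg (by positivity)]
    rw [habs, hF_integral, abs_mul, abs_of_pos (by positivity), abs_div, abs_pow, abs_neg,
      abs_of_nonneg (by positivity : 0 ≤ ρ ^ 2 * u), Nat.abs_cast]
  refine (setIntegral_congr_fun measurableSet_Ioi fun t _ => ?_).trans
    ((hasSum_integral_of_summable_integral_norm hF_int ?_).tsum_eq.symm.trans ?_)
  · rw [← (hasSum_besselJ 0 (ρ * t)).tsum_eq, ← tsum_mul_left]
    refine tsum_congr fun m => ?_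
    rw [hF, add_zero, mul_div_right_comm, mul_pow]
    ring
  · simp only [hF_norm]
    exact (hexp _).summable.mul_left _
  · simp only [hF_integral]
    exact ((hexp _).mul_left _).tsum_eq

lemma intervalIntegral_setIntegral_swap_of_norm_le {F : ℝ → ℝ → ℝ} {g : ℝ → ℝ} {s : Set ℝ}
    (hs : MeasurableSet s) (hF : ContinuousOn (Function.uncurry F) (univ ×ˢ s))
    (hg : IntegrableOn g s) (hle : ∀ θ, ∀ t ∈ s, ‖F θ t‖ ≤ g t) (a b : ℝ) :
    ∫ θ in a..b, ∫ t in s, F θ t = ∫ t in s, ∫ θ in a..b, F θ t := by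
  refine intervalIntegral_integral_swap ?_
  have hconst : IntegrableOn (fun _ => (1 : ℝ)) (uIoc a b) := intervalIntegrable_const.def'
  have hmaj := hconst.mul_prod hg
  refine hmaj.mono' ?_ ?_ <;> rw [Measure.prod_restrict]
  · exact (hF.mono (prod_mono_left (subset_univ _))).aestronglyMeasurable
      (measurableSet_uIoc.prod hs)
  · filter_upwards [ae_restrict_mem (measurableSet_uIoc.prod hs)] with q hq
    rw [one_mul]
    exact hle q.1 q.2 hq.2

lemma integral_mul_exp_mul_besselJ_mul_besselJ (n : ℕ) (b : ℝ) {u : ℝ} (hu : 0 < u) :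
    ∫ t in Ioi (0 : ℝ), Real.exp (-(t ^ 2 / (4 * u))) * (t * (besselJ n (b * t) * besselJ n t)) =
      u / π * ∫ θ in (0 : ℝ)..2 * π, Real.exp (-(chordSq b θ * u)) * Real.cos (n * θ) := by
  obtain ⟨C, -, hC⟩ := exists_abs_besselJ_le 0
  set F : ℝ → ℝ → ℝ := fun θ t =>
    t * Real.exp (-(t ^ 2 / (4 * u))) * (besselJ 0 (√(chordSq b θ) * t) * Real.cos (n * θ))
  have hle : ∀ θ, ∀ t ∈ Ioi 0,
      ‖F θ t‖ ≤ t ^ (2 * 0 + 1) * Real.exp (-(t ^ 2 / (4 * u))) * C := fun θ t (ht : 0 < t) => by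
    have hJ : ‖besselJ 0 (√(chordSq b θ) * t) * Real.cos (n * θ)‖ ≤ C := by
      rw [norm_mul]
      exact (mul_le_of_le_one_right (norm_nonneg _) (Real.abs_cos_le_one _)).trans
        (hC _ (by positivity))
    rw [norm_mul, Real.norm_of_nonneg (by positivity), mul_zero, zero_add, pow_one]
    gcongr
  have hswap := intervalIntegral_setIntegral_swap_of_norm_le measurableSet_Ioi
    (by fun_prop : Continuous (Function.uncurry F)).continuousOn
    ((integrableOn_pow_mul_exp_neg_sq_div hu 0).mul_const C) hle 0 (2 * π)
  have hinner (θ : ℝ) : ∫ t in Ioi 0, F θ t =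
      2 * u * (Real.exp (-(chordSq b θ * u)) * Real.cos (n * θ)) := by
    simp only [F, ← mul_assoc]
    rw [integral_mul_const, integral_mul_exp_mul_besselJ_zero hu, Real.sq_sqrt (chordSq_nonneg b θ)]
  have houter (t : ℝ) : ∫ θ in 0..2 * π, F θ t = 2 * π *
      (Real.exp (-(t ^ 2 / (4 * u))) * (t * (besselJ n (b * t) * besselJ n t))) := by
    rw [intervalIntegral.integral_const_mul, ← two_pi_mul_besselJ_mul_besselJ]
    ring
  simp only [hinner, houter, intervalIntegral.integral_const_mul, integral_const_mul] at hswap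
  rw [div_mul_eq_mul_div, eq_div_iff Real.pi_ne_zero]
  linear_combination -hswap / 2

lemma integral_rpow_mul_exp_neg_div {s t : ℝ} (hs : s < 1) (ht : 0 < t) :
    ∫ u in Ioi (0 : ℝ), u ^ (s - 2) * Real.exp (-(t ^ 2 / (4 * u))) =
      Real.Gamma (1 - s) * 4 ^ (1 - s) * t ^ (2 * s - 2) := by
  have hgamma := Real.integral_rpow_mul_exp_neg_mul_Ioi (a := 1 - s) (r := t ^ 2 / 4)
    (by linarith) (by positivity)
  have hinv := integral_comp_rpow_Ioi
    (fun u : ℝ => u ^ (s - 2) * Real.exp (-(t ^ 2 / (4 * u)))) (p := -1) (by norm_num)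
  have hintegrand : ∀ x ∈ Ioi (0 : ℝ), (|(-1 : ℝ)| * x ^ ((-1 : ℝ) - 1)) •
      ((x ^ (-1 : ℝ)) ^ (s - 2) * Real.exp (-(t ^ 2 / (4 * x ^ (-1 : ℝ))))) =
      x ^ (1 - s - 1) * Real.exp (-(t ^ 2 / 4 * x)) := fun x hx => by
    have hx' : (0 : ℝ) < x := hx
    rw [← Real.rpow_mul hx'.le, smul_eq_mul, abs_neg, abs_one, one_mul, ← mul_assoc,
      ← Real.rpow_add hx', Real.rpow_neg_one]
    congr 2
    · ring
    · field_simp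
  rw [← hinv, setIntegral_congr_fun measurableSet_Ioi hintegrand, hgamma, one_div_div,
    Real.div_rpow (by norm_num) (by positivity), ← Real.rpow_natCast, ← Real.rpow_mul ht.le,
    show 2 * s - 2 = -((2 : ℕ) * (1 - s)) by push_cast; ring, Real.rpow_neg ht.le]
  ring

lemma integrableOn_rpow_mul_exp_neg_div {s t : ℝ} (hs : s < 1) (ht : 0 < t) :
    IntegrableOn (fun u => u ^ (s - 2) * Real.exp (-(t ^ 2 / (4 * u)))) (Ioi 0) := by
  have : 0 < 1 - s := sub_pos.2 hs
  refine not_imp_comm.1 integral_undef ?_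
  rw [integral_rpow_mul_exp_neg_div hs ht]
  positivity

lemma integrable_prod_mul_rpow_mul_exp_neg_div {s : ℝ} (hs : s < 1) {f : ℝ → ℝ}
    (hf : ContinuousOn f (Ioi 0)) (hfi : IntegrableOn (fun t => t ^ (2 * s - 2) * f t) (Ioi 0)) :
    Integrable (fun q : ℝ × ℝ => f q.1 * (q.2 ^ (s - 2) * Real.exp (-(q.1 ^ 2 / (4 * q.2)))))
      ((volume.restrict (Ioi 0)).prod (volume.restrict (Ioi 0))) := by
  have : 0 < 1 - s := sub_pos.2 hs
  have hmeas : AEStronglyMeasurable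
      (fun q : ℝ × ℝ => f q.1 * (q.2 ^ (s - 2) * Real.exp (-(q.1 ^ 2 / (4 * q.2)))))
      ((volume.restrict (Ioi 0)).prod (volume.restrict (Ioi 0))) := by
    rw [Measure.prod_restrict]
    refine ContinuousOn.aestronglyMeasurable ?_ (measurableSet_Ioi.prod measurableSet_Ioi)
    refine (hf.comp continuousOn_fst fun q hq => hq.1).mul (ContinuousOn.mul ?_ ?_)
    · exact continuousOn_snd.rpow_const fun q hq => Or.inl (ne_of_gt hq.2)
    · refine Real.continuous_exp.comp_continuousOn (ContinuousOn.neg (ContinuousOn.div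
        (by fun_prop) (by fun_prop) fun q hq => ?_))
      have : (0 : ℝ) < q.2 := hq.2
      positivity
  refine (integrable_prod_iff hmeas).2 ⟨?_, ?_⟩
  · filter_upwards [ae_restrict_mem measurableSet_Ioi] with t ht
    exact (integrableOn_rpow_mul_exp_neg_div hs ht).const_mul _
  · refine (hfi.norm.const_mul (Real.Gamma (1 - s) * 4 ^ (1 - s))).congr ?_
    filter_upwards [ae_restrict_mem measurableSet_Ioi] with t (ht : 0 < t)
    have hnorm : ∀ u ∈ Ioi (0 : ℝ), ‖f t * (u ^ (s - 2) * Real.exp (-(t ^ 2 / (4 * u))))‖ =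
        ‖f t‖ * (u ^ (s - 2) * Real.exp (-(t ^ 2 / (4 * u)))) := fun u (hu : 0 < u) => by
      rw [norm_mul, Real.norm_of_nonneg (by positivity : 0 ≤ u ^ (s - 2) * _)]
    rw [setIntegral_congr_fun measurableSet_Ioi hnorm, integral_const_mul,
      integral_rpow_mul_exp_neg_div hs ht, norm_mul, Real.norm_of_nonneg (by positivity)]
    ring

lemma Gamma_mul_integral_rpow_mul {s : ℝ} (hs : s < 1) {f : ℝ → ℝ}
    (hf : ContinuousOn f (Ioi 0)) (hfi : IntegrableOn (fun t => t ^ (2 * s - 2) * f t) (Ioi 0)) :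
    Real.Gamma (1 - s) * 4 ^ (1 - s) * ∫ t in Ioi (0 : ℝ), t ^ (2 * s - 2) * f t =
      ∫ u in Ioi (0 : ℝ), u ^ (s - 2) *
        ∫ t in Ioi (0 : ℝ), Real.exp (-(t ^ 2 / (4 * u))) * f t := by
  have hswap := integral_integral_swap (f := fun t u => f t * (u ^ (s - 2) *
    Real.exp (-(t ^ 2 / (4 * u))))) (integrable_prod_mul_rpow_mul_exp_neg_div hs hf hfi)
  rw [← integral_const_mul]
  refine (setIntegral_congr_fun measurableSet_Ioi fun t ht => ?_).trans (hswap.trans ?_)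
  · rw [integral_const_mul, integral_rpow_mul_exp_neg_div hs ht]
    ring
  · refine integral_congr_ae (Eventually.of_forall fun u => ?_)
    simp only [← integral_const_mul]
    exact integral_congr_ae (Eventually.of_forall fun t => by ring)

-- Writing `t^{2s-2}` as a superposition of Gaussians `e^{-t²/4u}` reduces the integral to Gaussian
-- integrals of Bessel functions, which are elementary.
lemma Gamma_mul_integral_lambdaIntegrand {s : ℝ} (hs : s ∈ Ioo 0 (1 / 2)) (n : ℕ) {b : ℝ}
    (hb : 0 < b) :
    Real.Gamma (1 - s) * 4 ^ (1 - s) * π * ∫ t in Ioi (0 : ℝ), lambdaIntegrand (2 * s) n b t =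
      ∫ u in Ioi (0 : ℝ), u ^ (s - 1) *
        ∫ θ in (0 : ℝ)..2 * π, Real.exp (-(chordSq b θ * u)) * Real.cos (n * θ) := by
  have hpow : ∀ t ∈ Ioi (0 : ℝ), t ^ (2 * s - 2) * (t * (besselJ n (b * t) * besselJ n t)) =
      lambdaIntegrand (2 * s) n b t := fun t (ht : 0 < t) => by
    rw [← mul_assoc, ← Real.rpow_add_one ht.ne', lambdaIntegrand, div_eq_inv_mul,
      ← Real.rpow_neg ht.le]
    ring_nf
  have hfi := (integrableOn_congr_fun hpow measurableSet_Ioi).2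
    (integrableOn_lambdaIntegrand (α := 2 * s) ⟨by linarith [hs.1], by linarith [hs.2]⟩ n hb)
  have h := Gamma_mul_integral_rpow_mul (by linarith [hs.2])
    (by fun_prop : Continuous _).continuousOn hfi
  rw [setIntegral_congr_fun measurableSet_Ioi hpow] at h
  rw [mul_right_comm, h, ← integral_mul_const]
  refine setIntegral_congr_fun measurableSet_Ioi fun u (hu : 0 < u) => ?_
  rw [integral_mul_exp_mul_besselJ_mul_besselJ n b hu, show s - 1 = s - 2 + 1 by ring,
    Real.rpow_add_one hu.ne']
  field_simp

/-! ### Euler integrals -/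

lemma integral_rpow_mul_integral_exp_neg_chordSq_mul {s b : ℝ} (hs : 0 < s)
    (hb : b ∈ Ico (0 : ℝ) 1) (n : ℕ) :
    ∫ u in Ioi (0 : ℝ), u ^ (s - 1) *
        ∫ θ in (0 : ℝ)..2 * π, Real.exp (-(chordSq b θ * u)) * Real.cos (n * θ) =
      Real.Gamma s * ∫ θ in (0 : ℝ)..2 * π, chordSq b θ ^ (-s) * Real.cos (n * θ) := by
  have hb2 : 0 < (1 - b) ^ 2 := pow_pos (sub_pos.2 hb.2) 2
  have hpos (θ : ℝ) : 0 < chordSq b θ := hb2.trans_le (sq_one_sub_le_chordSq hb.1 θ)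
  set F : ℝ → ℝ → ℝ := fun θ u => u ^ (s - 1) * Real.exp (-(chordSq b θ * u)) * Real.cos (n * θ)
  have hcont : ContinuousOn (Function.uncurry F) (univ ×ˢ Ioi 0) := by
    refine (ContinuousOn.mul ?_ ?_).mul ?_
    · exact continuousOn_snd.rpow_const fun q hq => Or.inl (ne_of_gt hq.2)
    · exact (by fun_prop : Continuous fun q : ℝ × ℝ =>
        Real.exp (-(chordSq b q.1 * q.2))).continuousOn
    · exact (by fun_prop : Continuous fun q : ℝ × ℝ => Real.cos (n * q.1)).continuousOn
  have hmaj : IntegrableOn (fun u => u ^ (s - 1) * Real.exp (-((1 - b) ^ 2 * u))) (Ioi 0) := by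
    refine not_imp_comm.1 integral_undef ?_
    rw [Real.integral_rpow_mul_exp_neg_mul_Ioi hs hb2]
    positivity
  have hle : ∀ θ, ∀ u ∈ Ioi 0, ‖F θ u‖ ≤ u ^ (s - 1) * Real.exp (-((1 - b) ^ 2 * u)) :=
    fun θ u (hu : 0 < u) => by
      rw [norm_mul, Real.norm_of_nonneg (by positivity)]
      refine (mul_le_of_le_one_right (by positivity) (Real.abs_cos_le_one _)).trans ?_
      gcongr
      exact sq_one_sub_le_chordSq hb.1 θ
  have hswap := intervalIntegral_setIntegral_swap_of_norm_le measurableSet_Ioi hcont hmaj hle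
    0 (2 * π)
  have hinner (θ : ℝ) : ∫ u in Ioi 0, F θ u =
      Real.Gamma s * (chordSq b θ ^ (-s) * Real.cos (n * θ)) := by
    rw [integral_mul_const, Real.integral_rpow_mul_exp_neg_mul_Ioi hs (hpos θ), one_div,
      Real.inv_rpow (hpos θ).le, ← Real.rpow_neg (hpos θ).le]
    ring
  simp only [hinner, intervalIntegral.integral_const_mul] at hswap
  simp only [hswap, F, mul_assoc, intervalIntegral.integral_const_mul]

lemma multichoose_eq_Gamma_div {s : ℝ} (hs : 0 < s) (k : ℕ) :
    Ring.multichoose s k = Real.Gamma (s + k) / (Real.Gamma s * k !) := by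
  have hascPochhammer : Real.Gamma (s + k) = (ascPochhammer ℝ k).eval s * Real.Gamma s := by
    induction k with
    | zero => simp
    | succ k ih =>
      rw [Nat.cast_succ, ← add_assoc, Real.Gamma_add_one (by positivity), ih,
        ascPochhammer_succ_eval]
      ring
  have h := Ring.factorial_nsmul_multichoose_eq_ascPochhammer s k
  rw [nsmul_eq_mul, Polynomial.ascPochhammer_smeval_eq_eval] at h
  have := (Real.Gamma_pos_of_pos hs).ne'
  rw [hascPochhammer, ← h]
  field_simp

lemma multichoose_pos {s : ℝ} (hs : 0 < s) (k : ℕ) : 0 < Ring.multichoose s k := by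
  rw [multichoose_eq_Gamma_div hs]
  positivity

lemma hasSum_multichoose_mul_pow (s : ℝ) {x : ℝ} (hx : |x| < 1) :
    HasSum (fun k => Ring.multichoose s k * x ^ k) ((1 - x) ^ (-s)) := by
  have h := (Real.one_div_one_sub_rpow_hasFPowerSeriesOnBall_zero s).hasSum (y := x)
    (by rw [← ENNReal.ofReal_one, Metric.eball_ofReal]; simpa using hx)
  rw [zero_add, one_div, ← Real.rpow_neg (by linarith [le_abs_self x])] at h
  refine h.congr_fun fun k => ?_
  simp [Ring.multichoose_eq, mul_comm]

lemma hasSum_multichoose_mul_cpow (s : ℝ) {z : ℂ} (hz : ‖z‖ < 1) :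
    HasSum (fun k => ((Ring.multichoose s k : ℝ) : ℂ) * z ^ k) ((1 - z) ^ (-(s : ℂ))) := by
  have h := (Complex.one_div_one_sub_cpow_hasFPowerSeriesOnBall_zero (s : ℂ)).hasSum (y := z)
    (by rw [← ENNReal.ofReal_one, Metric.eball_ofReal]; simpa using hz)
  rw [zero_add, one_div, ← Complex.cpow_neg] at h
  refine h.congr_fun fun k => ?_
  simp [Ring.multichoose_eq, Complex.ofReal_choose, mul_comm]

lemma hasSum_integral_chordSq_rpow_mul_cos (s : ℝ) {b : ℝ} (hb : |b| < 1) (n : ℕ) :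
    HasSum (fun k => 2 * π *
        (Ring.multichoose s (n + k) * Ring.multichoose s k * b ^ (n + 2 * k)))
      (∫ θ in (0 : ℝ)..2 * π, chordSq b θ ^ (-s) * Real.cos (n * θ)) := by
  have hseries : ∀ z : ℂ, ‖z‖ = 1 → HasSum (fun k =>
      ((Ring.multichoose s k * b ^ k : ℝ) : ℂ) * z ^ k) ((1 - b * z) ^ (-(s : ℂ))) :=
    fun z hz => (hasSum_multichoose_mul_cpow s (z := b * z) (by simpa [hz] using hb)).congr_fun
      fun k => by push_cast; ring
  have hnorm (θ : ℝ) : ‖(1 - b * Complex.exp (θ * Complex.I)) ^ (-(s : ℂ))‖ ^ 2 =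
      chordSq b θ ^ (-s) := by
    rw [← norm_one_sub_mul_exp_sq, ← Complex.ofReal_neg, Complex.norm_cpow_real,
      ← Real.rpow_natCast, ← Real.rpow_natCast, ← Real.rpow_mul (norm_nonneg _),
      ← Real.rpow_mul (norm_nonneg _), mul_comm (-s)]
  have h := hasSum_integral_norm_sq_mul_cos (hasSum_multichoose_mul_pow s hb).summable hseries n
  simp only [hnorm] at h
  exact h.congr_fun fun k => by ring

lemma integral_rpow_mul_one_sub_rpow {p q : ℝ} (hp : 0 < p) (hq : 0 < q) :
    ∫ x in Ioo (0 : ℝ) 1, x ^ (p - 1) * (1 - x) ^ (q - 1) =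
      Real.Gamma p * Real.Gamma q / Real.Gamma (p + q) := by
  have h := Complex.betaIntegral_eq_Gamma_mul_div (p : ℂ) (q : ℂ) (by simpa) (by simpa)
  have hreal : ∫ x in Ioo (0 : ℝ) 1, (x : ℂ) ^ ((p : ℂ) - 1) * (1 - (x : ℂ)) ^ ((q : ℂ) - 1) =
      ∫ x in Ioo (0 : ℝ) 1, ((x ^ (p - 1) * (1 - x) ^ (q - 1) : ℝ) : ℂ) := by
    refine setIntegral_congr_fun measurableSet_Ioo fun x hx => ?_
    rw [Complex.ofReal_mul, Complex.ofReal_cpow hx.1.le, Complex.ofReal_cpow (sub_pos.2 hx.2).le]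
    push_cast
    rfl
  rw [Complex.betaIntegral, intervalIntegral.integral_of_le zero_le_one,
    integral_Ioc_eq_integral_Ioo, hreal, integral_complex_ofReal, Complex.Gamma_ofReal,
    Complex.Gamma_ofReal, ← Complex.ofReal_add, Complex.Gamma_ofReal] at h
  exact_mod_cast h

lemma integrableOn_rpow_mul_one_sub_rpow {p q : ℝ} (hp : 0 < p) (hq : 0 < q) :
    IntegrableOn (fun x : ℝ => x ^ (p - 1) * (1 - x) ^ (q - 1)) (Ioo 0 1) := by
  refine not_imp_comm.1 integral_undef ?_
  rw [integral_rpow_mul_one_sub_rpow hp hq]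
  positivity

/-- The integrand of Euler's integral for the hypergeometric function `F(n+s, s; n+1; b²)`. -/
noncomputable def eulerIntegrand (s : ℝ) (n : ℕ) (b x : ℝ) : ℝ :=
  x ^ (n + s - 1) * (1 - x) ^ (-s) * (1 - b ^ 2 * x) ^ (-s)

/-- Euler's integral for the hypergeometric function `F(n+s, s; n+1; b²)`, without the
normalizing factor `Γ(n+1) / (Γ(n+s) Γ(1-s))`. -/
noncomputable def eulerIntegral (s : ℝ) (n : ℕ) (b : ℝ) : ℝ :=
  ∫ x in Ioo (0 : ℝ) 1, eulerIntegrand s n b x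

lemma integral_multichoose_mul_rpow {s : ℝ} (hs : s ∈ Ioo (0 : ℝ) 1) (n k : ℕ) :
    ∫ x in Ioo (0 : ℝ) 1, Ring.multichoose s k * (x ^ (n + k + s - 1) * (1 - x) ^ (1 - s - 1)) =
      Real.Gamma s * Real.Gamma (1 - s) * (Ring.multichoose s (n + k) * Ring.multichoose s k) := by
  have := (Real.Gamma_pos_of_pos hs.1).ne'
  have hpos : 0 < (n + k + s : ℝ) := add_pos_of_nonneg_of_pos (by positivity) hs.1
  rw [integral_const_mul, integral_rpow_mul_one_sub_rpow hpos (sub_pos.2 hs.2),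
    show (n : ℝ) + k + s + (1 - s) = (n + k : ℕ) + 1 by push_cast; ring,
    Real.Gamma_nat_eq_factorial, multichoose_eq_Gamma_div hs.1 (n + k), Nat.cast_add,
    add_comm s (n + k)]
  field_simp

lemma hasSum_multichoose_mul_multichoose {s b : ℝ} (hs : s ∈ Ioo (0 : ℝ) 1)
    (hb : b ∈ Ico (0 : ℝ) 1) (n : ℕ) :
    HasSum (fun k => Real.Gamma s * Real.Gamma (1 - s) *
        (Ring.multichoose s (n + k) * Ring.multichoose s k * b ^ (n + 2 * k)))
      (b ^ n * eulerIntegral s n b) := by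
  have habs : |b| < 1 := by rw [abs_of_nonneg hb.1]; exact hb.2
  set F : ℕ → ℝ → ℝ := fun k x =>
    b ^ (n + 2 * k) * (Ring.multichoose s k * (x ^ (n + k + s - 1) * (1 - x) ^ (1 - s - 1)))
  have hF_int (k : ℕ) : IntegrableOn (F k) (Ioo 0 1) :=
    ((integrableOn_rpow_mul_one_sub_rpow (add_pos_of_nonneg_of_pos (by positivity) hs.1)
      (sub_pos.2 hs.2)).const_mul _).const_mul _
  have hF_integral (k : ℕ) : ∫ x in Ioo 0 1, F k x = Real.Gamma s * Real.Gamma (1 - s) *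
      (Ring.multichoose s (n + k) * Ring.multichoose s k * b ^ (n + 2 * k)) := by
    rw [integral_const_mul, integral_multichoose_mul_rpow hs]
    ring
  have hF_norm (k : ℕ) : ∫ x in Ioo 0 1, ‖F k x‖ = ∫ x in Ioo 0 1, F k x := by
    refine setIntegral_congr_fun measurableSet_Ioo fun x hx => Real.norm_of_nonneg ?_
    have h0 : 0 < x := hx.1
    have h1 : 0 < 1 - x := sub_pos.2 hx.2
    have h2 := multichoose_pos hs.1 k
    have h3 := hb.1
    positivity
  have hsum : ∀ x ∈ Ioo (0 : ℝ) 1, ∑' k, F k x = b ^ n * eulerIntegrand s n b x := fun x hx => by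
    have hbx : |b ^ 2 * x| < 1 := by
      have h0 : 0 < x := hx.1
      rw [abs_of_nonneg (by positivity)]
      nlinarith [hb.1, hb.2, hx.2]
    rw [eulerIntegrand, ← ((hasSum_multichoose_mul_pow s hbx).mul_left _).tsum_eq, ← tsum_mul_left]
    refine tsum_congr fun k => ?_
    simp only [F]
    rw [show (n : ℝ) + k + s - 1 = n + s - 1 + k by ring, Real.rpow_add_natCast hx.1.ne',
      show 1 - s - 1 = -s by ring]
    ring
  have h := hasSum_integral_of_summable_integral_norm hF_int ?_
  · rw [setIntegral_congr_fun measurableSet_Ioo hsum, integral_const_mul] at h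
    exact h.congr_fun fun k => (hF_integral k).symm
  · simp only [hF_norm, hF_integral]
    exact ((summable_mul_left_iff Real.two_pi_pos.ne').1
      (hasSum_integral_chordSq_rpow_mul_cos s habs n).summable).mul_left _

lemma Gamma_mul_Gamma_mul_integral_chordSq_rpow_mul_cos {s b : ℝ} (hs : s ∈ Ioo (0 : ℝ) 1)
    (hb : b ∈ Ico (0 : ℝ) 1) (n : ℕ) :
    Real.Gamma s * Real.Gamma (1 - s) *
        ∫ θ in (0 : ℝ)..2 * π, chordSq b θ ^ (-s) * Real.cos (n * θ) =
      2 * π * (b ^ n * eulerIntegral s n b) := by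
  have habs : |b| < 1 := by rw [abs_of_nonneg hb.1]; exact hb.2
  refine ((hasSum_integral_chordSq_rpow_mul_cos s habs n).mul_left _).unique ?_
  refine ((hasSum_multichoose_mul_multichoose hs hb n).mul_left (2 * π)).congr_fun
    fun k => ?_
  ring

lemma one_sub_sq_mul_pos {b x : ℝ} (hb : b ∈ Ioc (0 : ℝ) 1) (hx : x < 1) : 0 < 1 - b ^ 2 * x := by
  nlinarith [mul_pos hb.1 hb.1, mul_nonneg hb.1.le (sub_nonneg.2 hb.2), hb.2]

lemma eulerIntegrand_pos (s : ℝ) (n : ℕ) {b x : ℝ} (hb : b ∈ Ioc (0 : ℝ) 1)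
    (hx : x ∈ Ioo (0 : ℝ) 1) : 0 < eulerIntegrand s n b x := by
  have h0 := hx.1
  have h1 := sub_pos.2 hx.2
  have h2 := one_sub_sq_mul_pos hb hx.2
  rw [eulerIntegrand]
  positivity

lemma eulerIntegrand_le_of_le {s : ℝ} (hs : 0 ≤ s) (n : ℕ) {b c x : ℝ} (hb : 0 < b)
    (hbc : b ≤ c) (hc : c ≤ 1) (hx : x ∈ Ioo (0 : ℝ) 1) :
    eulerIntegrand s n b x ≤ eulerIntegrand s n c x := by
  have h0 := hx.1
  have h1 := sub_pos.2 hx.2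
  have h2 := one_sub_sq_mul_pos ⟨hb.trans_le hbc, hc⟩ hx.2
  rw [eulerIntegrand, eulerIntegrand]
  refine mul_le_mul_of_nonneg_left (Real.rpow_le_rpow_of_nonpos h2 ?_ (neg_nonpos.2 hs))
    (by positivity)
  gcongr

lemma eulerIntegrand_one (s : ℝ) (n : ℕ) {x : ℝ} (hx : x < 1) :
    eulerIntegrand s n 1 x = x ^ (n + s - 1) * (1 - x) ^ (1 - 2 * s - 1) := by
  rw [eulerIntegrand, one_pow, one_mul, mul_assoc, ← Real.rpow_add (sub_pos.2 hx)]
  ring_nf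

lemma aestronglyMeasurable_eulerIntegrand (s : ℝ) (n : ℕ) {b : ℝ} (hb : b ∈ Ioc (0 : ℝ) 1) :
    AEStronglyMeasurable (eulerIntegrand s n b) (volume.restrict (Ioo 0 1)) := by
  refine ContinuousOn.aestronglyMeasurable ((ContinuousOn.mul ?_ ?_).mul ?_) measurableSet_Ioo
  · exact continuousOn_id.rpow_const fun x hx => Or.inl (ne_of_gt hx.1)
  · exact ContinuousOn.rpow_const (by fun_prop) fun x hx => Or.inl (sub_pos.2 hx.2).ne'
  · exact ContinuousOn.rpow_const (by fun_prop) fun x hx =>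
      Or.inl (one_sub_sq_mul_pos hb hx.2).ne'

lemma integrableOn_eulerIntegrand {s b : ℝ} (hs : s ∈ Ico (0 : ℝ) (1 / 2)) {n : ℕ} (hn : 1 ≤ n)
    (hb : b ∈ Ioc (0 : ℝ) 1) : IntegrableOn (eulerIntegrand s n b) (Ioo 0 1) := by
  have hn' : (1 : ℝ) ≤ n := Nat.one_le_cast.2 hn
  have hone : IntegrableOn (eulerIntegrand s n 1) (Ioo 0 1) :=
    (integrableOn_rpow_mul_one_sub_rpow (p := n + s) (q := 1 - 2 * s) (by linarith [hs.1])
      (by linarith [hs.2])).congr_fun (fun x hx => (eulerIntegrand_one s n hx.2).symm)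
      measurableSet_Ioo
  refine hone.mono' (aestronglyMeasurable_eulerIntegrand s n hb) ?_
  filter_upwards [ae_restrict_mem measurableSet_Ioo] with x hx
  rw [Real.norm_of_nonneg (eulerIntegrand_pos s n hb hx).le]
  exact eulerIntegrand_le_of_le hs.1 n hb.1 hb.2 le_rfl hx

lemma eulerIntegral_one {s : ℝ} (hs : s ∈ Ico (0 : ℝ) (1 / 2)) {n : ℕ} (hn : 1 ≤ n) :
    eulerIntegral s n 1 =
      Real.Gamma (n + s) * Real.Gamma (1 - 2 * s) / Real.Gamma (n + 1 - s) := by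
  have hn' : (1 : ℝ) ≤ n := Nat.one_le_cast.2 hn
  rw [eulerIntegral,
    setIntegral_congr_fun measurableSet_Ioo fun x hx => eulerIntegrand_one s n hx.2,
    integral_rpow_mul_one_sub_rpow (by linarith [hs.1]) (by linarith [hs.2])]
  ring_nf

lemma tendsto_eulerIntegral_one {s : ℝ} (hs : s ∈ Ico (0 : ℝ) (1 / 2)) {n : ℕ} (hn : 1 ≤ n) :
    Tendsto (eulerIntegral s n) (𝓝[<] 1) (𝓝 (eulerIntegral s n 1)) := by
  have hev : ∀ᶠ b : ℝ in 𝓝[<] 1, b ∈ Ioc (0 : ℝ) 1 :=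
    mem_of_superset (Ioo_mem_nhdsLT one_pos) Ioo_subset_Ioc_self
  refine tendsto_integral_filter_of_dominated_convergence (eulerIntegrand s n 1)
    (hev.mono fun b hb => aestronglyMeasurable_eulerIntegrand s n hb) (hev.mono fun b hb => ?_)
    (integrableOn_eulerIntegrand hs hn ⟨one_pos, le_rfl⟩) ?_
  · filter_upwards [ae_restrict_mem measurableSet_Ioo] with x hx
    rw [Real.norm_of_nonneg (eulerIntegrand_pos s n hb hx).le]
    exact eulerIntegrand_le_of_le hs.1 n hb.1 hb.2 le_rfl hx
  · filter_upwards [ae_restrict_mem measurableSet_Ioo] with x hx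
    have hcont : ContinuousAt (fun b => eulerIntegrand s n b x) 1 :=
      continuousAt_const.mul (ContinuousAt.rpow_const (by fun_prop)
        (Or.inl (one_sub_sq_mul_pos ⟨one_pos, le_rfl⟩ hx.2).ne'))
    exact hcont.tendsto.mono_left nhdsWithin_le_nhds

lemma integral_lambdaIntegrand_eq_eulerIntegral_of_lt_one {s b : ℝ} (hs : s ∈ Ioo 0 (1 / 2))
    (n : ℕ) (hb : b ∈ Ioo (0 : ℝ) 1) :
    ∫ t in Ioi (0 : ℝ), lambdaIntegrand (2 * s) n b t =
      2 ^ (2 * s - 1) / Real.Gamma (1 - s) ^ 2 * (b ^ n * eulerIntegral s n b) := by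
  have hs1 : s < 1 := by linarith [hs.2]
  have : 0 < Real.Gamma (1 - s) := Real.Gamma_pos_of_pos (sub_pos.2 hs1)
  have hbessel := Gamma_mul_integral_lambdaIntegrand hs n hb.1
  rw [integral_rpow_mul_integral_exp_neg_chordSq_mul hs.1 ⟨hb.1.le, hb.2⟩] at hbessel
  have heuler := Gamma_mul_Gamma_mul_integral_chordSq_rpow_mul_cos ⟨hs.1, hs1⟩ ⟨hb.1.le, hb.2⟩ n
  have hfour : (4 : ℝ) ^ (1 - s) * 2 ^ (2 * s - 1) = 2 := by
    rw [show (4 : ℝ) = 2 ^ (2 : ℝ) by norm_num, ← Real.rpow_mul (by norm_num),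
      ← Real.rpow_add (by norm_num), show 2 * (1 - s) + (2 * s - 1) = 1 by ring, Real.rpow_one]
  have hfour_pos : (0 : ℝ) < 4 ^ (1 - s) := by positivity
  rw [div_mul_eq_mul_div, eq_div_iff (by positivity)]
  refine mul_left_cancel₀ (mul_pos hfour_pos Real.pi_pos).ne' ?_
  linear_combination Real.Gamma (1 - s) * hbessel + heuler -
    π * (b ^ n * eulerIntegral s n b) * hfour

lemma integral_lambdaIntegrand_eq_eulerIntegral {s b : ℝ} (hs : s ∈ Ioo 0 (1 / 2)) {n : ℕ}
    (hn : 1 ≤ n) (hb : b ∈ Ioc (0 : ℝ) 1) :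
    ∫ t in Ioi (0 : ℝ), lambdaIntegrand (2 * s) n b t =
      2 ^ (2 * s - 1) / Real.Gamma (1 - s) ^ 2 * (b ^ n * eulerIntegral s n b) := by
  rcases hb.2.lt_or_eq with hlt | rfl
  · exact integral_lambdaIntegrand_eq_eulerIntegral_of_lt_one hs n ⟨hb.1, hlt⟩
  · have hleft := (continuousAt_integral_lambdaIntegrand (α := 2 * s)
      ⟨by linarith [hs.1], by linarith [hs.2]⟩ n one_pos).tendsto.mono_left
      (nhdsWithin_le_nhds (s := Iio 1))
    have hright := ((((continuous_pow n).tendsto (1 : ℝ)).mono_left nhdsWithin_le_nhds).mul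
      (tendsto_eulerIntegral_one ⟨hs.1.le, hs.2⟩ hn)).const_mul
      (2 ^ (2 * s - 1) / Real.Gamma (1 - s) ^ 2)
    refine tendsto_nhds_unique (hleft.congr' ?_) hright
    filter_upwards [Ioo_mem_nhdsLT one_pos] with b hb
    exact integral_lambdaIntegrand_eq_eulerIntegral_of_lt_one hs n hb

/-! ### Quotients of Gamma functions -/

lemma Gamma_add_le_rpow_mul_Gamma {x a : ℝ} (hx : 0 < x) (ha : a ∈ Ioo (0 : ℝ) 1) :
    Real.Gamma (x + a) ≤ x ^ a * Real.Gamma x := by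
  have hGamma := Real.Gamma_pos_of_pos hx
  have hconvex := Real.Gamma_mul_add_mul_le_rpow_Gamma_mul_rpow_Gamma (s := x) (t := x + 1)
    (a := 1 - a) (b := a) hx (by linarith) (sub_pos.2 ha.2) ha.1 (by ring)
  rwa [show (1 - a) * x + a * (x + 1) = x + a by ring, Real.Gamma_add_one hx.ne',
    Real.mul_rpow hx.le hGamma.le, mul_left_comm, ← Real.rpow_add hGamma, sub_add_cancel,
    Real.rpow_one] at hconvex

lemma rpow_mul_Gamma_mul_div_le_Gamma_add {x a : ℝ} (hx : 0 < x) (ha : a ∈ Ioo (0 : ℝ) 1) :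
    x ^ a * Real.Gamma x * (x / (x + a)) ≤ Real.Gamma (x + a) := by
  have hxa := add_pos hx ha.1
  have hupper := Gamma_add_le_rpow_mul_Gamma (a := 1 - a) hxa ⟨sub_pos.2 ha.2, by linarith [ha.1]⟩
  rw [show x + a + (1 - a) = x + 1 by ring, Real.Gamma_add_one hx.ne'] at hupper
  have hpow : (x + a) ^ (1 - a) * x ^ a ≤ x + a := by
    calc (x + a) ^ (1 - a) * x ^ a ≤ (x + a) ^ (1 - a) * (x + a) ^ a := by
          gcongr
          exacts [ha.1.le, le_add_of_nonneg_right ha.1.le]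
      _ = x + a := by rw [← Real.rpow_add hxa, sub_add_cancel, Real.rpow_one]
  rw [mul_div_assoc', div_le_iff₀ hxa]
  calc x ^ a * Real.Gamma x * x = x ^ a * (x * Real.Gamma x) := by ring
    _ ≤ x ^ a * ((x + a) ^ (1 - a) * Real.Gamma (x + a)) := by gcongr
    _ = (x + a) ^ (1 - a) * x ^ a * Real.Gamma (x + a) := by ring
    _ ≤ (x + a) * Real.Gamma (x + a) := by gcongr
    _ = Real.Gamma (x + a) * (x + a) := mul_comm _ _

lemma Gamma_add_div_Gamma_add_le {x s : ℝ} (hx : 0 < x) (hs : s ∈ Ioo (0 : ℝ) 1) :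
    Real.Gamma (x + s) / Real.Gamma (x + (1 - s)) ≤
      x ^ s / x ^ (1 - s) * ((x + (1 - s)) / x) := by
  have hs' := sub_pos.2 hs.2
  calc Real.Gamma (x + s) / Real.Gamma (x + (1 - s))
      ≤ x ^ s * Real.Gamma x / (x ^ (1 - s) * Real.Gamma x * (x / (x + (1 - s)))) := by
        gcongr
        · exact Gamma_add_le_rpow_mul_Gamma hx hs
        · exact rpow_mul_Gamma_mul_div_le_Gamma_add hx ⟨hs', by linarith [hs.1]⟩
    _ = x ^ s / x ^ (1 - s) * ((x + (1 - s)) / x) := by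
        have := Real.Gamma_pos_of_pos hx
        field_simp

lemma le_Gamma_add_div_Gamma_add {x s : ℝ} (hx : 0 < x) (hs : s ∈ Ioo (0 : ℝ) 1) :
    x ^ s / x ^ (1 - s) * (x / (x + s)) ≤ Real.Gamma (x + s) / Real.Gamma (x + (1 - s)) := by
  have hs0 := hs.1
  have hs' := sub_pos.2 hs.2
  calc x ^ s / x ^ (1 - s) * (x / (x + s))
      = x ^ s * Real.Gamma x * (x / (x + s)) / (x ^ (1 - s) * Real.Gamma x) := by
        have := Real.Gamma_pos_of_pos hx
        field_simp
    _ ≤ Real.Gamma (x + s) / Real.Gamma (x + (1 - s)) := by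
        gcongr
        · exact rpow_mul_Gamma_mul_div_le_Gamma_add hx hs
        · exact Gamma_add_le_rpow_mul_Gamma hx ⟨hs', by linarith⟩

lemma abs_Gamma_div_Gamma_sub_rpow_le {x s : ℝ} (hx : 0 < x) (hs : s ∈ Ioo (0 : ℝ) 1) :
    |Real.Gamma (x + s) / Real.Gamma (x + 1 - s) - x ^ (2 * s - 1)| ≤ x ^ (2 * s - 2) := by
  obtain ⟨hs0, hs1⟩ := hs
  have hpow : x ^ s / x ^ (1 - s) = x ^ (2 * s - 2) * x := by
    rw [← Real.rpow_sub hx, ← Real.rpow_add_one hx.ne']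
    ring_nf
  have hpow' : x ^ (2 * s - 1) = x ^ (2 * s - 2) * x := by
    rw [← Real.rpow_add_one hx.ne']
    ring_nf
  have hupper := Gamma_add_div_Gamma_add_le hx ⟨hs0, hs1⟩
  have hlower := le_Gamma_add_div_Gamma_add hx ⟨hs0, hs1⟩
  have hle_upper : x * ((x + (1 - s)) / x) ≤ x + 1 := by
    rw [mul_div_cancel₀ _ hx.ne']
    linarith
  have hlower_le : x - 1 ≤ x * (x / (x + s)) := by
    rw [mul_div_assoc', le_div_iff₀ (by linarith)]
    nlinarith
  have hP : 0 ≤ x ^ (2 * s - 2) := by positivity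
  rw [hpow, mul_assoc] at hupper hlower
  rw [hpow', add_sub_assoc, abs_le]
  constructor
  · linarith [mul_le_mul_of_nonneg_left hlower_le hP]
  · linarith [mul_le_mul_of_nonneg_left hle_upper hP]

/-- The terms of the double series for `log Γ(1-z) - log Γ(1+z) - 2γz`: the outer index `q.1 + 1`
runs over the factors of the Weierstrass product, the inner index `q.2` over the Taylor series of
the logarithm of that factor. -/
noncomputable def logGammaTerm (z : ℝ) (q : ℕ × ℕ) : ℝ :=
  2 / (2 * q.2 + 3) * (z / (q.1 + 1)) ^ (2 * q.2 + 3)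

lemma summable_logGammaTerm {z : ℝ} (hz : z ∈ Ioo (0 : ℝ) 1) : Summable (logGammaTerm z) := by
  obtain ⟨hz0, hz1⟩ := hz
  have hgeom : Summable fun m : ℕ => 2 * z ^ 3 * (z ^ 2) ^ m :=
    (summable_geometric_of_lt_one (by positivity) (by nlinarith)).mul_left _
  have hsq : Summable fun j : ℕ => 1 / ((j : ℝ) + 1) ^ 2 := by
    simpa using (summable_nat_add_iff 1).2 (Real.summable_one_div_nat_pow.2 one_lt_two)
  refine Summable.of_nonneg_of_le (fun q => ?_) (fun q => ?_)
    (hsq.mul_of_nonneg hgeom (fun j => by positivity) (fun m => by positivity))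
  · rw [logGammaTerm]
    positivity
  · have hcoeff : 2 / (2 * (q.2 : ℝ) + 3) ≤ 2 := div_le_self two_pos.le
      (by linarith [(Nat.cast_nonneg q.2 : (0 : ℝ) ≤ q.2)])
    have hpow : ((q.1 : ℝ) + 1) ^ 2 ≤ ((q.1 : ℝ) + 1) ^ (2 * q.2 + 3) :=
      pow_le_pow_right₀ (by simp) (by lia)
    calc logGammaTerm z q
        = 2 / (2 * (q.2 : ℝ) + 3) * (z ^ (2 * q.2 + 3) / ((q.1 : ℝ) + 1) ^ (2 * q.2 + 3)) := by
          rw [logGammaTerm, div_pow]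
      _ ≤ 2 * (z ^ (2 * q.2 + 3) / ((q.1 : ℝ) + 1) ^ 2) := by gcongr
      _ = 1 / ((q.1 : ℝ) + 1) ^ 2 * (2 * z ^ 3 * (z ^ 2) ^ q.2) := by
          rw [pow_add, pow_mul]
          ring

lemma div_natCast_add_one_mem_Ioo {z : ℝ} (hz : z ∈ Ioo (0 : ℝ) 1) (j : ℕ) :
    z / (j + 1) ∈ Ioo (0 : ℝ) 1 :=
  ⟨div_pos hz.1 (by positivity), (div_le_self hz.1.le (by simp)).trans_lt hz.2⟩

lemma hasSum_logGammaTerm_snd {z : ℝ} (hz : z ∈ Ioo (0 : ℝ) 1) (j : ℕ) :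
    HasSum (fun m => logGammaTerm z (j, m))
      (Real.log (1 + z / (j + 1)) - Real.log (1 - z / (j + 1)) - 2 * z * (1 / (j + 1))) := by
  have hmem := div_natCast_add_one_mem_Ioo hz j
  have hlog := (hasSum_nat_add_iff' 1).2 (Real.hasSum_log_sub_log_of_abs_lt_one
    (by rw [abs_of_pos hmem.1]; exact hmem.2))
  have hfirst : 2 * z * (1 / (j + 1)) =
      ∑ i ∈ Finset.range 1, 2 * (1 / (2 * (i : ℝ) + 1)) * (z / (j + 1)) ^ (2 * i + 1) := by
    rw [Finset.sum_range_one]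
    push_cast
    ring
  rw [hfirst]
  refine hlog.congr_fun fun m => ?_
  rw [logGammaTerm]
  push_cast
  ring_nf

lemma re_riemannZeta_odd_eq_tsum (m : ℕ) :
    (riemannZeta (2 * ((m : ℂ) + 1) + 1)).re = ∑' j : ℕ, 1 / ((j : ℝ) + 1) ^ (2 * m + 3) := by
  have hzeta := zeta_nat_eq_tsum_of_gt_one (k := 2 * m + 3) (by lia)
  have hsummable : Summable fun n : ℕ => 1 / (n : ℝ) ^ (2 * m + 3) :=
    Real.summable_one_div_nat_pow.2 (by lia)
  have hreal : ∑' n : ℕ, 1 / (n : ℂ) ^ (2 * m + 3) =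
      ((∑' n : ℕ, 1 / (n : ℝ) ^ (2 * m + 3) : ℝ) : ℂ) := by
    push_cast
    rfl
  rw [show ((2 * m + 3 : ℕ) : ℂ) = 2 * ((m : ℂ) + 1) + 1 by push_cast; ring] at hzeta
  rw [hzeta, hreal, Complex.ofReal_re, hsummable.tsum_eq_zero_add]
  simp

lemma tsum_logGammaTerm_fst (z : ℝ) (m : ℕ) :
    ∑' j : ℕ, logGammaTerm z (j, m) =
      (2 * z) ^ (2 * (m + 1) + 1) / (2 ^ (2 * (m + 1)) * (2 * ((m : ℝ) + 1) + 1)) *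
        (riemannZeta (2 * ((m : ℂ) + 1) + 1)).re := by
  rw [re_riemannZeta_odd_eq_tsum, ← tsum_mul_left]
  refine tsum_congr fun j => ?_
  rw [logGammaTerm, show 2 * (m + 1) + 1 = 2 * m + 3 by ring,
    show 2 * ((m : ℝ) + 1) + 1 = 2 * m + 3 by ring, div_pow, mul_pow,
    show (2 : ℝ) ^ (2 * m + 3) = 2 * 2 ^ (2 * (m + 1)) by ring]
  field_simp

lemma hasSum_cAlpha {z : ℝ} (hz : z ∈ Ioo (0 : ℝ) 1) :
    HasSum (fun j : ℕ => Real.log (1 + z / (j + 1)) - Real.log (1 - z / (j + 1))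
      - 2 * z * (1 / (j + 1))) (cAlpha (2 * z)) := by
  have hsummable := summable_logGammaTerm hz
  have hswap : ∑' q, logGammaTerm z q = cAlpha (2 * z) := by
    rw [cAlpha, ← (Equiv.prodComm ℕ ℕ).tsum_eq]
    exact hsummable.prod_symm.tsum_prod.trans (tsum_congr fun m => tsum_logGammaTerm_fst z m)
  rw [← hswap]
  exact hsummable.hasSum.prod_fiberwise (hasSum_logGammaTerm_snd hz)

lemma GammaSeq_neg_div_GammaSeq {z : ℝ} (hz : z ≠ 0) {n : ℕ} (hn : 0 < n) :
    -(Real.GammaSeq (-z) n / Real.GammaSeq z n) =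
      (n : ℝ) ^ (-(2 * z)) * ∏ j ∈ Finset.range n, (z + (j + 1)) / (-z + (j + 1)) := by
  have hn0 : (0 : ℝ) < n := Nat.cast_pos.2 hn
  have hpow := (Real.rpow_pos_of_pos hn0 z).ne'
  have hfactorial : (n ! : ℝ) ≠ 0 := by positivity
  simp only [Real.GammaSeq, Finset.prod_range_succ' _ n, Finset.prod_div_distrib, Nat.cast_add,
    Nat.cast_one, Nat.cast_zero, add_zero, show -(2 * z) = -z - z by ring, Real.rpow_sub hn0]
  rw [div_div_div_eq]
  field_simp

lemma exp_log_one_add_sub_log_one_sub {x : ℝ} (hx : x ∈ Ioo (0 : ℝ) 1) :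
    Real.exp (Real.log (1 + x) - Real.log (1 - x)) = (1 + x) / (1 - x) := by
  rw [Real.exp_sub, Real.exp_log (add_pos one_pos hx.1), Real.exp_log (sub_pos.2 hx.2)]

/- The partial sums of the series for `cAlpha` exponentiate to the ratio of the Euler products
`Real.GammaSeq (-z) n` and `Real.GammaSeq z n`; the subtracted harmonic sums supply `γ`. -/
lemma exp_mul_harmonic_sub_log_add_sum {z : ℝ} (hz : z ∈ Ioo (0 : ℝ) 1) {n : ℕ} (hn : 0 < n) :
    Real.exp (2 * z * ((harmonic n : ℝ) - Real.log n) +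
        ∑ j ∈ Finset.range n, (Real.log (1 + z / (j + 1)) - Real.log (1 - z / (j + 1))
          - 2 * z * (1 / (j + 1)))) =
      -(Real.GammaSeq (-z) n / Real.GammaSeq z n) := by
  have hexponent : 2 * z * ((harmonic n : ℝ) - Real.log n) +
      ∑ j ∈ Finset.range n, (Real.log (1 + z / (j + 1)) - Real.log (1 - z / (j + 1))
        - 2 * z * (1 / (j + 1))) = Real.log n * (-(2 * z)) +
      ∑ j ∈ Finset.range n, (Real.log (1 + z / (j + 1)) - Real.log (1 - z / (j + 1))) := by
    rw [Finset.sum_sub_distrib, ← Finset.mul_sum, harmonic]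
    push_cast
    simp only [one_div]
    ring
  rw [hexponent, Real.exp_add, ← Real.rpow_def_of_pos (Nat.cast_pos.2 hn), Real.exp_sum,
    GammaSeq_neg_div_GammaSeq hz.1.ne' hn]
  congr 1
  refine Finset.prod_congr rfl fun j _ => ?_
  have hj : (0 : ℝ) < j + 1 := by positivity
  rw [exp_log_one_add_sub_log_one_sub (div_natCast_add_one_mem_Ioo hz j),
    ← mul_div_mul_right _ _ hj.ne', add_mul, sub_mul, div_mul_cancel₀ _ hj.ne']
  ring_nf

lemma exp_mul_eulerMascheroniConstant_add_cAlpha {z : ℝ} (hz : z ∈ Ioo (0 : ℝ) 1) :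
    Real.exp (2 * z * Real.eulerMascheroniConstant + cAlpha (2 * z)) =
      Real.Gamma (1 - z) / Real.Gamma (1 + z) := by
  have hGamma := (Real.Gamma_pos_of_pos hz.1).ne'
  have hratio : Real.Gamma (1 - z) / Real.Gamma (1 + z) =
      -(Real.Gamma (-z) / Real.Gamma z) := by
    rw [add_comm 1 z, sub_eq_neg_add, Real.Gamma_add_one hz.1.ne',
      Real.Gamma_add_one (neg_ne_zero.2 hz.1.ne'), neg_mul, neg_div,
      mul_div_mul_left _ _ hz.1.ne']
  have hlim : Tendsto (fun n : ℕ => -(Real.GammaSeq (-z) n / Real.GammaSeq z n)) atTop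
      (𝓝 (Real.exp (2 * z * Real.eulerMascheroniConstant + cAlpha (2 * z)))) := by
    refine ((Real.continuous_exp.tendsto _).comp ((Real.tendsto_harmonic_sub_log.const_mul _).add
      (hasSum_cAlpha hz).tendsto_sum_nat)).congr' ?_
    filter_upwards [eventually_gt_atTop 0] with n hn
    exact exp_mul_harmonic_sub_log_add_sum hz hn
  rw [hratio]
  exact tendsto_nhds_unique hlim
    ((Real.GammaSeq_tendsto_Gamma (-z)).div (Real.GammaSeq_tendsto_Gamma z) hGamma).neg

/-! ### The Lommel primitive -/

/-- Lommel's function: `lommel n b / (1 - b²)` is a primitive of `t J_n(bt) J_n(t)`. -/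
noncomputable def lommel (n : ℕ) (b t : ℝ) : ℝ :=
  t * (besselJ n (b * t) * besselJ (n + 1) t - b * (besselJ (n + 1) (b * t) * besselJ n t))

lemma hasDerivAt_lommel (n : ℕ) {b t : ℝ} (hb : b ≠ 0) (ht : t ≠ 0) :
    HasDerivAt (lommel n b) ((1 - b ^ 2) * (t * (besselJ n (b * t) * besselJ n t))) t := by
  have hbt : b * t ≠ 0 := mul_ne_zero hb ht
  have hscale : HasDerivAt (fun t => b * t) b t := by simpa using (hasDerivAt_id t).const_mul b
  have hfirst : HasDerivAt (fun t => besselJ n (b * t)) _ t :=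
    (hasDerivAt_besselJ n hbt).comp t hscale
  have hsecond : HasDerivAt (fun t => besselJ (n + 1) (b * t)) _ t :=
    (hasDerivAt_besselJ_succ n hbt).comp t hscale
  refine ((hasDerivAt_id t).mul ((hfirst.mul (hasDerivAt_besselJ_succ n ht)).sub
    ((hsecond.mul (hasDerivAt_besselJ n ht)).const_mul b))).congr_deriv ?_
  simp only [id, Pi.sub_apply, Pi.mul_apply]
  field_simp
  ring

lemma continuous_lommel (n : ℕ) (b : ℝ) : Continuous (lommel n b) := by
  unfold lommel
  fun_prop

lemma exists_abs_lommel_le_mul_sq (n : ℕ) {b : ℝ} (hb : b ∈ Ioc (0 : ℝ) 1) :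
    ∃ C : ℝ, 0 < C ∧ ∀ t, 0 < t → |lommel n b t| ≤ C * t ^ 2 := by
  obtain ⟨hb0, hb1⟩ := hb
  obtain ⟨C, hC0, hC⟩ := exists_abs_besselJ_le n
  obtain ⟨D, hD0, hD⟩ := exists_abs_besselJ_succ_le_mul n
  refine ⟨2 * (C * D), by positivity, fun t ht => ?_⟩
  have hbt : b * t ≤ t := mul_le_of_le_one_left ht.le hb1
  have hbt0 : 0 ≤ b * t := by positivity
  rw [lommel, abs_mul, abs_of_pos ht]
  calc t * |besselJ n (b * t) * besselJ (n + 1) t - b * (besselJ (n + 1) (b * t) * besselJ n t)|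
      ≤ t * (|besselJ n (b * t)| * |besselJ (n + 1) t| +
          b * (|besselJ (n + 1) (b * t)| * |besselJ n t|)) := by
        gcongr
        refine (abs_sub _ _).trans_eq ?_
        rw [abs_mul, abs_mul, abs_mul, abs_of_pos hb0]
    _ ≤ t * (C * (D * t) + 1 * (D * t * C)) := by
        gcongr
        exacts [hC _ hbt0, hD t ht.le, (hD _ hbt0).trans (by gcongr), hC t ht.le]
    _ = 2 * (C * D) * t ^ 2 := by ring

lemma exists_abs_lommel_le (n : ℕ) {b : ℝ} (hb : 0 < b) :
    ∃ C : ℝ, ∀ t, 0 < t → |lommel n b t| ≤ C := by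
  obtain ⟨C, -, hC⟩ := exists_abs_mul_besselJ_le n (n + 1)
  obtain ⟨D, -, hD⟩ := exists_abs_mul_besselJ_le (n + 1) n
  refine ⟨(C + b * D) / √b, fun t ht => ?_⟩
  rw [lommel, abs_mul, abs_of_pos ht]
  calc t * |besselJ n (b * t) * besselJ (n + 1) t - b * (besselJ (n + 1) (b * t) * besselJ n t)|
      ≤ t * (C / (√b * t) + b * (D / (√b * t))) := by
        gcongr
        refine (abs_sub _ _).trans ?_
        rw [abs_mul b, abs_of_pos hb]
        gcongr
        exacts [hC b t hb ht, hD b t hb ht]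
    _ = (C + b * D) / √b := by
        have := Real.sqrt_pos.2 hb
        field_simp

lemma exists_abs_lommel_le_gluedRpow (n : ℕ) {b : ℝ} (hb : b ∈ Ioc (0 : ℝ) 1) :
    ∃ C : ℝ, 0 < C ∧ ∀ t, 0 < t → |lommel n b t| ≤ C * gluedRpow 2 0 t := by
  obtain ⟨C, hC0, hC⟩ := exists_abs_lommel_le_mul_sq n hb
  obtain ⟨D, hD⟩ := exists_abs_lommel_le n hb.1
  refine ⟨max C D, lt_max_of_lt_left hC0, fun t ht => ?_⟩
  rw [gluedRpow]
  split_ifs with h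
  · rw [Real.rpow_two]
    exact (hC t ht).trans (by gcongr; exact le_max_left C D)
  · rw [Real.rpow_zero, mul_one]
    exact (hD t ht).trans (le_max_right C D)

lemma rpow_mul_gluedRpow_le {c d r t : ℝ} (p q : ℝ) (hr : r ∈ Icc c d) (ht : 0 < t) :
    t ^ r * gluedRpow p q t ≤ gluedRpow (c + p) (d + q) t := by
  rw [gluedRpow, gluedRpow]
  split_ifs with h
  · rw [← Real.rpow_add ht]
    exact Real.rpow_le_rpow_of_exponent_ge ht h (by linarith [hr.1])
  · rw [← Real.rpow_add ht]
    exact Real.rpow_le_rpow_of_exponent_le (not_le.1 h).le (by linarith [hr.2])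

lemma exists_abs_rpow_mul_lommel_le (n : ℕ) {b : ℝ} (hb : b ∈ Ioc (0 : ℝ) 1) :
    ∃ C : ℝ, ∀ c d r t : ℝ, r ∈ Icc c d → 0 < t →
      |t ^ r * lommel n b t| ≤ C * gluedRpow (c + 2) (d + 0) t := by
  obtain ⟨C, hC0, hC⟩ := exists_abs_lommel_le_gluedRpow n hb
  refine ⟨C, fun c d r t hr ht => ?_⟩
  rw [abs_mul, abs_of_pos (Real.rpow_pos_of_pos ht _)]
  calc t ^ r * |lommel n b t| ≤ t ^ r * (C * gluedRpow 2 0 t) := by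
        gcongr
        exact hC t ht
    _ = C * (t ^ r * gluedRpow 2 0 t) := by ring
    _ ≤ C * gluedRpow (c + 2) (d + 0) t := by
        gcongr
        exact rpow_mul_gluedRpow_le 2 0 hr ht

lemma aestronglyMeasurable_rpow_mul_lommel (n : ℕ) (r b : ℝ) :
    AEStronglyMeasurable (fun t => t ^ r * lommel n b t) (volume.restrict (Ioi 0)) :=
  ((continuousOn_id.rpow_const fun _ ht => Or.inl (ne_of_gt ht)).mul
    (continuous_lommel n b).continuousOn).aestronglyMeasurable measurableSet_Ioi

lemma integrableOn_rpow_mul_lommel (n : ℕ) {r b : ℝ} (hr : r ∈ Ioo (-3 : ℝ) (-1))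
    (hb : b ∈ Ioc (0 : ℝ) 1) : IntegrableOn (fun t => t ^ r * lommel n b t) (Ioi 0) := by
  obtain ⟨C, hC⟩ := exists_abs_rpow_mul_lommel_le n hb
  refine ((integrableOn_gluedRpow (p := r + 2) (q := r + 0) (by linarith [hr.1])
    (by linarith [hr.2])).const_mul C).mono' (aestronglyMeasurable_rpow_mul_lommel n r b) ?_
  filter_upwards [ae_restrict_mem measurableSet_Ioi] with t ht
  exact hC r r r t ⟨le_rfl, le_rfl⟩ ht

lemma continuousAt_integral_rpow_mul_lommel (n : ℕ) {r b : ℝ} (hr : r ∈ Ioo (-3 : ℝ) (-1))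
    (hb : b ∈ Ioc (0 : ℝ) 1) :
    ContinuousAt (fun r => ∫ t in Ioi (0 : ℝ), t ^ r * lommel n b t) r := by
  obtain ⟨C, hC⟩ := exists_abs_rpow_mul_lommel_le n hb
  obtain ⟨c, hc, hcr⟩ := exists_between hr.1
  obtain ⟨d, hrd, hd⟩ := exists_between hr.2
  refine tendsto_integral_filter_of_dominated_convergence
    (fun t => C * gluedRpow (c + 2) (d + 0) t)
    (Eventually.of_forall fun r => aestronglyMeasurable_rpow_mul_lommel n r b) ?_
    ((integrableOn_gluedRpow (by linarith) (by linarith)).const_mul C) ?_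
  · filter_upwards [Icc_mem_nhds hcr hrd] with r' hr'
    filter_upwards [ae_restrict_mem measurableSet_Ioi] with t ht
    exact hC c d r' t hr' ht
  · filter_upwards [ae_restrict_mem measurableSet_Ioi] with t ht
    exact ((Real.continuous_const_rpow (ne_of_gt ht)).mul continuous_const).tendsto r

lemma tendsto_rpow_mul_lommel_nhdsGT_zero (n : ℕ) {r b : ℝ} (hr : -2 < r)
    (hb : b ∈ Ioc (0 : ℝ) 1) : Tendsto (fun t => t ^ r * lommel n b t) (𝓝[>] 0) (𝓝 0) := by
  obtain ⟨C, hC⟩ := exists_abs_rpow_mul_lommel_le n hb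
  refine squeeze_zero_norm' (a := fun t => C * t ^ (r + 2)) ?_ ?_
  · filter_upwards [Ioo_mem_nhdsGT one_pos] with t ht
    refine (hC r r r t ⟨le_rfl, le_rfl⟩ ht.1).trans_eq ?_
    rw [gluedRpow, if_pos ht.2.le]
  · have hlim : Tendsto (fun t : ℝ => C * t ^ (r + 2)) (𝓝 0) (𝓝 (C * 0 ^ (r + 2))) :=
      (Real.continuousAt_rpow_const 0 (r + 2) (Or.inr (by linarith))).tendsto.const_mul C
    rw [Real.zero_rpow (by linarith), mul_zero] at hlim
    exact hlim.mono_left nhdsWithin_le_nhds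

lemma tendsto_rpow_mul_lommel_atTop (n : ℕ) {r b : ℝ} (hr : r < 0) (hb : b ∈ Ioc (0 : ℝ) 1) :
    Tendsto (fun t => t ^ r * lommel n b t) atTop (𝓝 0) := by
  obtain ⟨C, hC⟩ := exists_abs_rpow_mul_lommel_le n hb
  refine squeeze_zero_norm' (a := fun t => C * t ^ (-(-r))) ?_ ?_
  · filter_upwards [eventually_gt_atTop 1] with t ht
    refine (hC r r r t ⟨le_rfl, le_rfl⟩ (one_pos.trans ht)).trans_eq ?_
    rw [gluedRpow, if_neg (not_le.2 ht), add_zero, neg_neg]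
  · simpa using (tendsto_rpow_neg_atTop (neg_pos.2 hr)).const_mul C

lemma intervalIntegrable_lambdaIntegrand {α : ℝ} (hα : 0 < α) (n : ℕ) (b : ℝ) {R : ℝ}
    (hR : 0 ≤ R) : IntervalIntegrable (lambdaIntegrand α n b) volume 0 R := by
  have hcont : Continuous fun t => besselJ n (b * t) * besselJ n t := by fun_prop
  refine ((intervalIntegral.intervalIntegrable_rpow' (r := α - 1) (by linarith)).mul_continuousOn
    hcont.continuousOn).congr fun t ht => ?_
  rw [uIoc_of_le hR] at ht
  rw [lambdaIntegrand, div_eq_inv_mul, ← Real.rpow_neg ht.1.le, neg_sub]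

lemma hasDerivAt_rpow_mul_lommel (α : ℝ) (n : ℕ) {b t : ℝ} (hb : b ≠ 0) (ht : 0 < t) :
    HasDerivAt (fun t => t ^ (α - 2) * lommel n b t)
      ((1 - b ^ 2) * lambdaIntegrand α n b t - (2 - α) * (t ^ (α - 3) * lommel n b t)) t := by
  refine ((Real.hasDerivAt_rpow_const (Or.inl ht.ne')).mul
    (hasDerivAt_lommel n hb ht.ne')).congr_deriv ?_
  have hpow : t ^ (α - 2) * t = (t ^ (1 - α))⁻¹ := by
    rw [← Real.rpow_add_one ht.ne', ← Real.rpow_neg ht.le]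
    ring_nf
  rw [lambdaIntegrand, div_eq_mul_inv, ← hpow, show α - 2 - 1 = α - 3 by ring]
  ring

lemma one_sub_sq_mul_intervalIntegral_lambdaIntegrand {α : ℝ} (hα : α ∈ Ioo (0 : ℝ) 2) (n : ℕ)
    {b : ℝ} (hb : b ∈ Ioc (0 : ℝ) 1) {R : ℝ} (hR : 0 < R) :
    (1 - b ^ 2) * ∫ t in (0 : ℝ)..R, lambdaIntegrand α n b t =
      R ^ (α - 2) * lommel n b R + (2 - α) * ∫ t in (0 : ℝ)..R, t ^ (α - 3) * lommel n b t := by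
  have hlommel : IntervalIntegrable (fun t => (2 - α) * (t ^ (α - 3) * lommel n b t)) volume 0 R :=
    ((intervalIntegrable_iff_integrableOn_Ioc_of_le hR.le).2
      ((integrableOn_rpow_mul_lommel n ⟨by linarith [hα.1], by linarith [hα.2]⟩ hb).mono_set
        Ioc_subset_Ioi_self)).const_mul _
  have hlambda := (intervalIntegrable_lambdaIntegrand hα.1 n b hR.le).const_mul (1 - b ^ 2)
  have hftc := intervalIntegral.integral_eq_sub_of_hasDerivAt_of_tendsto hR
    (fun t ht => hasDerivAt_rpow_mul_lommel α n hb.1.ne' ht.1) (hlambda.sub hlommel)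
    (tendsto_rpow_mul_lommel_nhdsGT_zero n (by linarith [hα.1]) hb)
    ((hasDerivAt_rpow_mul_lommel α n hb.1.ne' hR).continuousAt.tendsto.mono_left nhdsWithin_le_nhds)
  rw [intervalIntegral.integral_sub hlambda hlommel, intervalIntegral.integral_const_mul,
    intervalIntegral.integral_const_mul] at hftc
  linarith

lemma tendsto_intervalIntegral_lambdaIntegrand {α : ℝ} (hα : α ∈ Ioo (0 : ℝ) 2) (n : ℕ) {b : ℝ}
    (hb : b ∈ Ioo (0 : ℝ) 1) :
    Tendsto (fun R => ∫ t in (0 : ℝ)..R, lambdaIntegrand α n b t) atTop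
      (𝓝 ((1 - b ^ 2)⁻¹ * ((2 - α) * ∫ t in Ioi (0 : ℝ), t ^ (α - 3) * lommel n b t))) := by
  have hb' : b ∈ Ioc (0 : ℝ) 1 := Ioo_subset_Ioc_self hb
  have hb2 : 1 - b ^ 2 ≠ 0 := by nlinarith [hb.1, hb.2]
  have hlim := ((tendsto_rpow_mul_lommel_atTop n (r := α - 2) (by linarith [hα.2]) hb').add
    ((intervalIntegral_tendsto_integral_Ioi 0 (integrableOn_rpow_mul_lommel n (r := α - 3)
      ⟨by linarith [hα.1], by linarith [hα.2]⟩ hb') tendsto_id).const_mul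
        (2 - α))).const_mul (1 - b ^ 2)⁻¹
  rw [zero_add] at hlim
  refine hlim.congr' ?_
  filter_upwards [eventually_gt_atTop 0] with R hR
  rw [id, ← one_sub_sq_mul_intervalIntegral_lambdaIntegrand hα n hb' hR, inv_mul_cancel_left₀ hb2]

lemma integral_lambdaIntegrand_eq_integral_lommel {α : ℝ} (hα : α ∈ Ioo (0 : ℝ) 1) (n : ℕ)
    {b : ℝ} (hb : b ∈ Ioo (0 : ℝ) 1) :
    ∫ t in Ioi (0 : ℝ), lambdaIntegrand α n b t =
      (1 - b ^ 2)⁻¹ * ((2 - α) * ∫ t in Ioi (0 : ℝ), t ^ (α - 3) * lommel n b t) :=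
  tendsto_nhds_unique
    (intervalIntegral_tendsto_integral_Ioi 0 (integrableOn_lambdaIntegrand hα n hb.1) tendsto_id)
    (tendsto_intervalIntegral_lambdaIntegrand ⟨hα.1, hα.2.trans one_lt_two⟩ n hb)

/- For `α → 1⁻` the defining integral of `Lam` loses absolute convergence; integration by parts
against `lommel` turns it into an absolutely convergent one that is continuous in `α` up to `1`. -/
lemma exists_tendsto_integral_mul_besselJ (n : ℕ) {b : ℝ} (hb : b ∈ Ioo (0 : ℝ) 1) :
    ∃ I : ℝ, Tendsto (fun R : ℝ => ∫ t in (0 : ℝ)..R, besselJ n (b * t) * besselJ n t)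
      atTop (𝓝 I) ∧ Tendsto (fun α : ℝ => Lam α n b) (𝓝[<] 1) (𝓝 (1 / b * I)) := by
  refine ⟨_, by simpa [lambdaIntegrand] using
    tendsto_intervalIntegral_lambdaIntegrand (α := 1) ⟨one_pos, one_lt_two⟩ n hb, ?_⟩
  have hcont : ContinuousAt (fun α => 1 / b * ((1 - b ^ 2)⁻¹ *
      ((2 - α) * ∫ t in Ioi (0 : ℝ), t ^ (α - 3) * lommel n b t))) 1 :=
    (((continuousAt_const.sub continuousAt_id).mul
      (ContinuousAt.comp (f := fun α : ℝ => α - 3) (continuousAt_integral_rpow_mul_lommel n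
        (by norm_num) (Ioo_subset_Ioc_self hb)) (by fun_prop))).const_mul _).const_mul _
  refine (hcont.tendsto.mono_left nhdsWithin_le_nhds).congr' ?_
  filter_upwards [Ioo_mem_nhdsLT one_pos] with α hα
  rw [Lam, integral_lambdaIntegrand_eq_integral_lommel hα n hb]

/-! ### Signs and monotonicity -/

lemma half_mem_Ioo {α : ℝ} (hα : α ∈ Ioo (0 : ℝ) 1) : α / 2 ∈ Ioo (0 : ℝ) (1 / 2) :=
  ⟨by linarith [hα.1], by linarith [hα.2]⟩

lemma setIntegral_Ioo_lt {f g : ℝ → ℝ} {a b : ℝ} (hab : a < b) (hf : IntegrableOn f (Ioo a b))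
    (hg : IntegrableOn g (Ioo a b)) (hfg : ∀ x ∈ Ioo a b, f x < g x) :
    ∫ x in Ioo a b, f x < ∫ x in Ioo a b, g x := by
  have hdiff := (intervalIntegrable_iff_integrableOn_Ioo_of_le hab.le).2 (hg.sub hf)
  rw [← sub_pos, ← integral_sub hg hf, ← integral_Ioc_eq_integral_Ioo,
    ← intervalIntegral.integral_of_le hab.le]
  exact intervalIntegral.intervalIntegral_pos_of_pos_on hdiff
    (fun x hx => sub_pos.2 (hfg x hx)) hab

lemma eulerIntegral_pos {s b : ℝ} (hs : s ∈ Ico (0 : ℝ) (1 / 2)) {n : ℕ} (hn : 1 ≤ n)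
    (hb : b ∈ Ioc (0 : ℝ) 1) : 0 < eulerIntegral s n b := by
  simpa [eulerIntegral] using setIntegral_Ioo_lt one_pos integrableOn_zero
    (integrableOn_eulerIntegrand hs hn hb) fun x hx => eulerIntegrand_pos s n hb hx

lemma strictMonoOn_eulerIntegral {s : ℝ} (hs : s ∈ Ioo (0 : ℝ) (1 / 2)) {n : ℕ} (hn : 1 ≤ n) :
    StrictMonoOn (eulerIntegral s n) (Ioc 0 1) := by
  intro b hb c hc hbc
  have hs' := Ioo_subset_Ico_self hs
  refine setIntegral_Ioo_lt one_pos (integrableOn_eulerIntegrand hs' hn hb)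
    (integrableOn_eulerIntegrand hs' hn hc) fun x hx => ?_
  have hx0 := hx.1
  have hx1 := sub_pos.2 hx.2
  have hb0 := hb.1
  refine mul_lt_mul_of_pos_left ?_ (by positivity)
  refine Real.rpow_lt_rpow_of_neg (one_sub_sq_mul_pos hc hx.2) ?_ (neg_neg_of_pos hs.1)
  gcongr

lemma strictAntiOn_eulerIntegral {s b : ℝ} (hs : s ∈ Ico (0 : ℝ) (1 / 2))
    (hb : b ∈ Ioc (0 : ℝ) 1) : StrictAntiOn (fun n => eulerIntegral s n b) (Ici 1) := by
  intro m hm n hn hmn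
  refine setIntegral_Ioo_lt one_pos (integrableOn_eulerIntegrand hs hn hb)
    (integrableOn_eulerIntegrand hs hm hb) fun x hx => ?_
  have hx1 := sub_pos.2 hx.2
  have hbx := one_sub_sq_mul_pos hb hx.2
  have hpow : x ^ (n + s - 1) < x ^ (m + s - 1) :=
    Real.rpow_lt_rpow_of_exponent_gt hx.1 hx.2 (by gcongr)
  rw [eulerIntegrand, eulerIntegrand]
  gcongr

lemma Lam_eq {α b : ℝ} (hα : α ∈ Ioo (0 : ℝ) 1) {n : ℕ} (hn : 1 ≤ n) (hb : b ∈ Ioc (0 : ℝ) 1) :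
    Lam α n b = 2 ^ (α - 1) / Real.Gamma (1 - α / 2) ^ 2 *
      (b ^ (n - 1) * eulerIntegral (α / 2) n b) := by
  have h := integral_lambdaIntegrand_eq_eulerIntegral (half_mem_Ioo hα) hn hb
  rw [mul_div_cancel₀ α two_ne_zero] at h
  have := hb.1.ne'
  rw [Lam, h, ← mul_pow_sub_one (Nat.one_le_iff_ne_zero.1 hn) b]
  field_simp

lemma Lam_coeff_pos {α : ℝ} (hα : α < 2) :
    0 < 2 ^ (α - 1) / Real.Gamma (1 - α / 2) ^ 2 := by
  have := Real.Gamma_pos_of_pos (by linarith : 0 < 1 - α / 2)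
  positivity

lemma Lam_pos {α b : ℝ} (hα : α ∈ Ioo (0 : ℝ) 1) {n : ℕ} (hn : 1 ≤ n)
    (hb : b ∈ Ioc (0 : ℝ) 1) : 0 < Lam α n b := by
  rw [Lam_eq hα hn hb]
  exact mul_pos (Lam_coeff_pos (by linarith [hα.2])) (mul_pos (pow_pos hb.1 _)
    (eulerIntegral_pos (Ioo_subset_Ico_self (half_mem_Ioo hα)) hn hb))

lemma strictMonoOn_Lam {α : ℝ} (hα : α ∈ Ioo (0 : ℝ) 1) {n : ℕ} (hn : 1 ≤ n) :
    StrictMonoOn (Lam α n) (Ioc 0 1) := by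
  intro b hb c hc hbc
  have hs := half_mem_Ioo hα
  rw [Lam_eq hα hn hb, Lam_eq hα hn hc]
  refine mul_lt_mul_of_pos_left ?_ (Lam_coeff_pos (by linarith [hα.2]))
  exact mul_lt_mul' (pow_le_pow_left₀ hb.1.le hbc.le _) (strictMonoOn_eulerIntegral hs hn hb hc hbc)
    (eulerIntegral_pos (Ioo_subset_Ico_self hs) hn hb).le (pow_pos hc.1 _)

lemma strictAntiOn_Lam {α b : ℝ} (hα : α ∈ Ioo (0 : ℝ) 1) (hb : b ∈ Ioc (0 : ℝ) 1) :
    StrictAntiOn (fun n => Lam α n b) (Ici 1) := by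
  intro m hm n hn hmn
  have hs := Ioo_subset_Ico_self (half_mem_Ioo hα)
  simp only [Lam_eq hα hm hb, Lam_eq hα hn hb]
  refine mul_lt_mul_of_pos_left ?_ (Lam_coeff_pos (by linarith [hα.2]))
  exact mul_lt_mul' (pow_le_pow_of_le_one hb.1.le hb.2 (by omega))
    (strictAntiOn_eulerIntegral hs hb hm hn hmn) (eulerIntegral_pos hs hn hb).le (pow_pos hb.1 _)

lemma strictMonoOn_Theta {α : ℝ} (hα : α ∈ Ioo (0 : ℝ) 1) : StrictMonoOn (Theta α) (Ici 1) :=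
  fun _ hm _ hn hmn =>
    sub_lt_sub_left (strictAntiOn_Lam hα ⟨one_pos, le_rfl⟩ hm hn hmn) (Lam α 1 1)

lemma Theta_nonneg {α : ℝ} (hα : α ∈ Ioo (0 : ℝ) 1) {n : ℕ} (hn : 1 ≤ n) : 0 ≤ Theta α n := by
  simpa [Theta] using (strictMonoOn_Theta hα).monotoneOn self_mem_Ici (mem_Ici.2 hn) hn

/-! ### Limits in `α` -/

lemma eulerIntegrand_le_rpow {s t : ℝ} (hs : s ∈ Icc 0 t) {n : ℕ} (hn : 1 ≤ n) {b x : ℝ}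
    (hb : b ∈ Ioc (0 : ℝ) 1) (hx : x ∈ Ioo (0 : ℝ) 1) :
    eulerIntegrand s n b x ≤ (1 - x) ^ (-(2 * t)) := by
  have hn' : (1 : ℝ) ≤ n := Nat.one_le_cast.2 hn
  have hx1 : 0 < 1 - x := sub_pos.2 hx.2
  calc eulerIntegrand s n b x ≤ eulerIntegrand s n 1 x :=
        eulerIntegrand_le_of_le hs.1 n hb.1 hb.2 le_rfl hx
    _ = x ^ (n + s - 1) * (1 - x) ^ (1 - 2 * s - 1) := eulerIntegrand_one s n hx.2
    _ ≤ 1 * (1 - x) ^ (-(2 * t)) := by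
        gcongr ?_ * ?_
        · exact Real.rpow_le_one hx.1.le hx.2.le (by linarith [hs.1])
        · exact Real.rpow_le_rpow_of_exponent_ge hx1 (by linarith [hx.1]) (by linarith [hs.2])
    _ = (1 - x) ^ (-(2 * t)) := one_mul _

lemma continuousOn_eulerIntegral {n : ℕ} (hn : 1 ≤ n) {b : ℝ} (hb : b ∈ Ioc (0 : ℝ) 1) :
    ContinuousOn (fun s => eulerIntegral s n b) (Ico 0 (1 / 2)) := by
  intro s hs
  obtain ⟨t, hst, ht⟩ := exists_between hs.2
  have hIcc : ∀ᶠ r in 𝓝[Ico 0 (1 / 2)] s, r ∈ Icc 0 t := by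
    filter_upwards [self_mem_nhdsWithin,
      mem_nhdsWithin_of_mem_nhds (Iio_mem_nhds hst)] with r hr hrt
    exact ⟨hr.1, le_of_lt hrt⟩
  refine tendsto_integral_filter_of_dominated_convergence (fun x => (1 - x) ^ (-(2 * t)))
    (Eventually.of_forall fun r => aestronglyMeasurable_eulerIntegrand r n hb)
    (hIcc.mono fun r hr => ?_) ?_ ?_
  · filter_upwards [ae_restrict_mem measurableSet_Ioo] with x hx
    rw [Real.norm_of_nonneg (eulerIntegrand_pos r n hb hx).le]
    exact eulerIntegrand_le_rpow hr hn hb hx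
  · simpa [IntegrableOn] using
      integrableOn_rpow_mul_one_sub_rpow one_pos (by linarith : 0 < 1 - 2 * t)
  · filter_upwards [ae_restrict_mem measurableSet_Ioo] with x hx
    have hcont : Continuous fun r => eulerIntegrand r n b x :=
      (((Real.continuous_const_rpow hx.1.ne').comp (by fun_prop)).mul
        ((Real.continuous_const_rpow (sub_pos.2 hx.2).ne').comp (by fun_prop))).mul
        ((Real.continuous_const_rpow (one_sub_sq_mul_pos hb hx.2).ne').comp (by fun_prop))
    exact (hcont.tendsto s).mono_left nhdsWithin_le_nhds

lemma eulerIntegral_zero {n : ℕ} (hn : 1 ≤ n) (b : ℝ) : eulerIntegral 0 n b = 1 / n := by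
  have hn' : (0 : ℝ) < n := Nat.cast_pos.2 hn
  have h := integral_rpow_mul_one_sub_rpow hn' one_pos
  rw [Real.Gamma_one, Real.Gamma_add_one hn'.ne', mul_one,
    div_mul_cancel_right₀ (Real.Gamma_pos_of_pos hn').ne'] at h
  simpa [eulerIntegral, eulerIntegrand] using h

lemma continuousAt_Gamma_comp {f : ℝ → ℝ} {x : ℝ} (hf : ContinuousAt f x) (hx : 0 < f x) :
    ContinuousAt (fun y => Real.Gamma (f y)) x :=
  (Real.differentiableAt_Gamma fun m =>
    ((neg_nonpos.2 m.cast_nonneg).trans_lt hx).ne').continuousAt.comp hf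

lemma continuous_two_rpow_sub_one : Continuous fun α : ℝ => (2 : ℝ) ^ (α - 1) :=
  (Real.continuous_const_rpow two_ne_zero).comp (continuous_id.sub continuous_const)

lemma tendsto_half_nhdsGT_zero : Tendsto (fun α : ℝ => α / 2) (𝓝[>] 0) (𝓝[Ico 0 (1 / 2)] 0) := by
  refine tendsto_nhdsWithin_iff.2 ⟨?_, ?_⟩
  · simpa using ((continuous_id.div_const (2 : ℝ)).tendsto 0).mono_left nhdsWithin_le_nhds
  · filter_upwards [Ioo_mem_nhdsGT one_pos] with α hα
    exact Ioo_subset_Ico_self (half_mem_Ioo hα)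

lemma tendsto_Lam_nhdsGT_zero {n : ℕ} (hn : 1 ≤ n) {b : ℝ} (hb : b ∈ Ioc (0 : ℝ) 1) :
    Tendsto (fun α => Lam α n b) (𝓝[>] 0) (𝓝 (b ^ (n - 1) / (2 * n))) := by
  have hcoeff : ContinuousAt (fun α : ℝ => (2 : ℝ) ^ (α - 1) / Real.Gamma (1 - α / 2) ^ 2) 0 :=
    continuous_two_rpow_sub_one.continuousAt.div
      ((continuousAt_Gamma_comp (by fun_prop) (by norm_num)).pow 2) (by simp)
  have heuler : Tendsto (fun α => eulerIntegral (α / 2) n b) (𝓝[>] 0) (𝓝 (1 / n)) := by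
    rw [← eulerIntegral_zero hn b]
    exact (continuousOn_eulerIntegral hn hb 0 (by norm_num)).tendsto.comp tendsto_half_nhdsGT_zero
  have hlim := (hcoeff.tendsto.mono_left nhdsWithin_le_nhds).mul (heuler.const_mul (b ^ (n - 1)))
  have hvalue : (2 : ℝ) ^ ((0 : ℝ) - 1) / Real.Gamma (1 - 0 / 2) ^ 2 * (b ^ (n - 1) * (1 / n)) =
      b ^ (n - 1) / (2 * n) := by
    rw [zero_sub, Real.rpow_neg_one, zero_div, sub_zero, Real.Gamma_one]
    ring
  rw [hvalue] at hlim
  refine hlim.congr' ?_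
  filter_upwards [Ioo_mem_nhdsGT one_pos] with α hα
  exact (Lam_eq hα hn hb).symm

lemma tendsto_Theta_nhdsGT_zero {n : ℕ} (hn : 1 ≤ n) :
    Tendsto (fun α => Theta α n) (𝓝[>] 0) (𝓝 (((n : ℝ) - 1) / (2 * n))) := by
  have hone : (1 : ℝ) ∈ Ioc (0 : ℝ) 1 := ⟨one_pos, le_rfl⟩
  have hn0 : (n : ℝ) ≠ 0 := by positivity
  convert (tendsto_Lam_nhdsGT_zero le_rfl hone).sub (tendsto_Lam_nhdsGT_zero hn hone) using 2
  · rfl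
  · rw [one_pow, one_pow, Nat.cast_one]
    field_simp

lemma Lam_one {α : ℝ} (hα : α ∈ Ioo (0 : ℝ) 1) {n : ℕ} (hn : 1 ≤ n) :
    Lam α n 1 = 2 ^ (α - 1) * Real.Gamma (1 - α) / Real.Gamma (1 - α / 2) ^ 2 *
      (Real.Gamma (n + α / 2) / Real.Gamma (n + 1 - α / 2)) := by
  rw [Lam_eq hα hn ⟨one_pos, le_rfl⟩, eulerIntegral_one (Ioo_subset_Ico_self (half_mem_Ioo hα)) hn,
    mul_div_cancel₀ α two_ne_zero, one_pow]
  ring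

lemma Lam_one_sub_Lam_one_succ {α : ℝ} (hα : α ∈ Ioo (0 : ℝ) 1) {n : ℕ} (hn : 1 ≤ n) :
    Lam α n 1 - Lam α (n + 1) 1 = 2 ^ (α - 1) * Real.Gamma (2 - α) / Real.Gamma (1 - α / 2) ^ 2 *
      (Real.Gamma (n + α / 2) / Real.Gamma (n + 2 - α / 2)) := by
  have hn' : (1 : ℝ) ≤ n := Nat.one_le_cast.2 hn
  have hden : 0 < (n : ℝ) + 1 - α / 2 := by linarith [hα.2]
  have := (Real.Gamma_pos_of_pos hden).ne'
  have := (Real.Gamma_pos_of_pos (by linarith [hα.2] : 0 < 1 - α / 2)).ne'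
  have hnum_succ : Real.Gamma (n + 1 + α / 2) = (n + α / 2) * Real.Gamma (n + α / 2) := by
    rw [← Real.Gamma_add_one (by linarith [hα.1]), add_right_comm]
  have hden_succ : Real.Gamma (n + 2 - α / 2) = (n + 1 - α / 2) * Real.Gamma (n + 1 - α / 2) := by
    rw [← Real.Gamma_add_one hden.ne']
    ring_nf
  have hcoeff_succ : Real.Gamma (2 - α) = (1 - α) * Real.Gamma (1 - α) := by
    rw [← Real.Gamma_add_one (by linarith [hα.2])]
    ring_nf
  rw [Lam_one hα hn, Lam_one hα (by omega), Nat.cast_succ, hnum_succ, add_assoc (n : ℝ) 1 1,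
    one_add_one_eq_two, hden_succ, hcoeff_succ]
  have : 2 * ((n : ℝ) + 1) - α ≠ 0 := by linarith
  field_simp
  ring

lemma tendsto_Lam_one_sub_Lam_one_succ {n : ℕ} (hn : 1 ≤ n) :
    Tendsto (fun α => Lam α n 1 - Lam α (n + 1) 1) (𝓝[<] 1) (𝓝 (2 / π * (1 / (2 * n + 1)))) := by
  have hn' : (1 : ℝ) ≤ n := Nat.one_le_cast.2 hn
  have hcont : ContinuousAt (fun α : ℝ => 2 ^ (α - 1) * Real.Gamma (2 - α) /
      Real.Gamma (1 - α / 2) ^ 2 * (Real.Gamma (n + α / 2) / Real.Gamma (n + 2 - α / 2))) 1 := by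
    refine ((continuous_two_rpow_sub_one.continuousAt.mul ?_).div (ContinuousAt.pow ?_ 2) ?_).mul
      (ContinuousAt.div ?_ ?_ ?_)
    · exact continuousAt_Gamma_comp (by fun_prop) (by norm_num)
    · exact continuousAt_Gamma_comp (by fun_prop) (by norm_num)
    · exact pow_ne_zero 2 (Real.Gamma_pos_of_pos (by norm_num)).ne'
    · exact continuousAt_Gamma_comp (by fun_prop) (by positivity)
    · exact continuousAt_Gamma_comp (by fun_prop) (by linarith)
    · exact (Real.Gamma_pos_of_pos (by linarith)).ne'
  have hvalue : (2 : ℝ) ^ ((1 : ℝ) - 1) * Real.Gamma (2 - 1) / Real.Gamma (1 - 1 / 2) ^ 2 *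
      (Real.Gamma (n + 1 / 2) / Real.Gamma (n + 2 - 1 / 2)) = 2 / π * (1 / (2 * n + 1)) := by
    have hden : Real.Gamma (n + 2 - 1 / 2) = (n + 1 / 2) * Real.Gamma (n + 1 / 2) := by
      rw [← Real.Gamma_add_one (by positivity)]
      ring_nf
    have := (Real.Gamma_pos_of_pos (by positivity : (0 : ℝ) < n + 1 / 2)).ne'
    rw [hden, sub_self, Real.rpow_zero, show (2 : ℝ) - 1 = 1 by norm_num, Real.Gamma_one,
      sub_half, Real.Gamma_one_half_eq, Real.sq_sqrt Real.pi_pos.le]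
    field_simp
  rw [← hvalue]
  refine (hcont.tendsto.mono_left nhdsWithin_le_nhds).congr' ?_
  filter_upwards [Ioo_mem_nhdsLT one_pos] with α hα
  exact (Lam_one_sub_Lam_one_succ hα hn).symm

lemma tendsto_Theta_nhdsLT_one {n : ℕ} (hn : 1 ≤ n) :
    Tendsto (fun α => Theta α n) (𝓝[<] 1)
      (𝓝 (2 / π * ∑ k ∈ Finset.Icc 1 (n - 1), 1 / (2 * (k : ℝ) + 1))) := by
  induction n, hn using Nat.le_induction with
  | base => simp [Theta]
  | succ n hn ih =>
    have hlim := ih.add (tendsto_Lam_one_sub_Lam_one_succ hn)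
    rw [← mul_add] at hlim
    rw [Nat.add_sub_cancel, ← Nat.sub_add_cancel hn, Finset.sum_Icc_succ_top (by omega),
      Nat.sub_add_cancel hn]
    refine hlim.congr fun α => ?_
    rw [Theta, Theta, sub_add_sub_cancel]

/-! ### Asymptotics as `n → ∞` -/

lemma kappa_eq {α : ℝ} (hα : α ∈ Ioo (0 : ℝ) 1) :
    kappa α = 2 ^ (α - 1) * Real.Gamma (1 - α) / Real.Gamma (1 - α / 2) ^ 2 := by
  obtain ⟨s, rfl⟩ : ∃ s, α = 2 * s := ⟨α / 2, by ring⟩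
  have hs : s ∈ Ioo (0 : ℝ) 1 := ⟨by linarith [hα.1], by linarith [hα.2]⟩
  have hone_sub := sub_pos.2 hs.2
  have hGamma_sub := (Real.Gamma_pos_of_pos hone_sub).ne'
  have hGamma_add := (Real.Gamma_pos_of_pos (add_pos one_pos hs.1)).ne'
  rw [kappa, exp_mul_eulerMascheroniConstant_add_cAlpha hs, Lam_one hα le_rfl, Nat.cast_one,
    mul_div_cancel_left₀ s two_ne_zero, add_sub_assoc, add_comm 1 (1 - s),
    Real.Gamma_add_one hone_sub.ne']
  field_simp

lemma abs_Lam_one_sub_kappa_div_le {α : ℝ} (hα : α ∈ Ioo (0 : ℝ) 1) {n : ℕ} (hn : 1 ≤ n) :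
    |Lam α n 1 - kappa α / (n : ℝ) ^ (1 - α)| ≤ |kappa α| * (1 / (n : ℝ) ^ (2 - α)) := by
  have hn0 : (0 : ℝ) < n := Nat.cast_pos.2 hn
  have hs := half_mem_Ioo hα
  have hratio := abs_Gamma_div_Gamma_sub_rpow_le hn0 (s := α / 2) ⟨hs.1, by linarith [hs.2]⟩
  rw [mul_div_cancel₀ α two_ne_zero] at hratio
  rw [Lam_one hα hn, ← kappa_eq hα, div_eq_mul_one_div (kappa α), ← mul_sub, abs_mul,
    one_div, one_div, ← Real.rpow_neg hn0.le, ← Real.rpow_neg hn0.le, neg_sub, neg_sub]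
  gcongr

lemma isBigO_Theta {α : ℝ} (hα : α ∈ Ioo (0 : ℝ) 1) :
    (fun n : ℕ => Theta α n - (Lam α 1 1 - kappa α / (n : ℝ) ^ (1 - α)))
      =O[atTop] (fun n : ℕ => 1 / (n : ℝ) ^ (2 - α)) := by
  refine IsBigO.of_bound |kappa α| ?_
  filter_upwards [eventually_ge_atTop 1] with n hn
  rw [Theta, sub_sub_sub_cancel_left, Real.norm_eq_abs, abs_sub_comm,
    Real.norm_of_nonneg (by positivity)]
  exact abs_Lam_one_sub_kappa_div_le hα hn

lemma tendsto_one_div_natCast_rpow {p : ℝ} (hp : 0 < p) :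
    Tendsto (fun n : ℕ => 1 / (n : ℝ) ^ p) atTop (𝓝 0) := by
  simpa only [one_div] using!
    ((tendsto_rpow_atTop hp).comp tendsto_natCast_atTop_atTop).inv_tendsto_atTop

lemma tendsto_Lam_one_sub_kappa_div {α : ℝ} (hα : α < 1) :
    Tendsto (fun n : ℕ => Lam α 1 1 - kappa α / (n : ℝ) ^ (1 - α)) atTop (𝓝 (Lam α 1 1)) := by
  simpa only [mul_one_div, mul_zero, sub_zero] using
    ((tendsto_one_div_natCast_rpow (sub_pos.2 hα)).const_mul (kappa α)).const_sub (Lam α 1 1)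

lemma tendsto_Theta_atTop {α : ℝ} (hα : α ∈ Ioo (0 : ℝ) 1) :
    Tendsto (Theta α) atTop (𝓝 (Lam α 1 1)) := by
  have herror := (isBigO_Theta hα).trans_tendsto (tendsto_one_div_natCast_rpow (by linarith [hα.2]))
  simpa using herror.add (tendsto_Lam_one_sub_kappa_div hα.2)

lemma isBigO_Lam {α b : ℝ} (hα : α ∈ Ioo (0 : ℝ) 1) (hb : b ∈ Ioc (0 : ℝ) 1) :
    (fun n : ℕ => Lam α n b) =O[atTop] (fun n : ℕ => b ^ (n - 1)) := by
  refine IsBigO.of_bound (2 ^ (α - 1) / Real.Gamma (1 - α / 2) ^ 2 * eulerIntegral (α / 2) 1 b) ?_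
  filter_upwards [eventually_ge_atTop 1] with n hn
  have hs := Ioo_subset_Ico_self (half_mem_Ioo hα)
  have heuler : eulerIntegral (α / 2) n b ≤ eulerIntegral (α / 2) 1 b :=
    (strictAntiOn_eulerIntegral hs hb).antitoneOn self_mem_Ici hn hn
  have hcoeff := Lam_coeff_pos (hα.2.trans one_lt_two)
  have hb0 := hb.1
  rw [Real.norm_of_nonneg (Lam_pos hα hn hb).le, Real.norm_of_nonneg (by positivity),
    Lam_eq hα hn hb, mul_assoc, mul_comm (b ^ (n - 1))]
  gcongr

lemma isBigO_pow_sub_one {b : ℝ} (hb : b ∈ Ioo (0 : ℝ) 1) (p : ℝ) :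
    (fun n : ℕ => b ^ (n - 1)) =O[atTop] (fun n : ℕ => 1 / (n : ℝ) ^ p) := by
  have hlog : 0 < -Real.log b := neg_pos.2 (Real.log_neg hb.1 hb.2)
  have hexp := ((isLittleO_exp_neg_mul_rpow_atTop hlog (-p)).isBigO.comp_tendsto
    tendsto_natCast_atTop_atTop).const_mul_left b⁻¹
  refine hexp.congr' ?_ (Eventually.of_forall fun n => ?_)
  · filter_upwards [eventually_ge_atTop 1] with n hn
    rw [Function.comp_apply, neg_neg, mul_comm (Real.log b), Real.exp_nat_mul, Real.exp_log hb.1,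
      ← mul_pow_sub_one (Nat.one_le_iff_ne_zero.1 hn), inv_mul_cancel_left₀ hb.1.ne']
  · simp only [Function.comp_apply, Real.rpow_neg n.cast_nonneg, one_div]

lemma isBigO_Lam_one_div_rpow {α b : ℝ} (hα : α ∈ Ioo (0 : ℝ) 1) (hb : b ∈ Ioo (0 : ℝ) 1) (p : ℝ) :
    (fun n : ℕ => Lam α n b) =O[atTop] (fun n : ℕ => 1 / (n : ℝ) ^ p) :=
  (isBigO_Lam hα (Ioo_subset_Ioc_self hb)).trans (isBigO_pow_sub_one hb p)

lemma tendsto_Lam_atTop {α b : ℝ} (hα : α ∈ Ioo (0 : ℝ) 1) (hb : b ∈ Ioo (0 : ℝ) 1) :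
    Tendsto (fun n : ℕ => Lam α n b) atTop (𝓝 0) :=
  (isBigO_Lam_one_div_rpow hα hb 1).trans_tendsto (tendsto_one_div_natCast_rpow one_pos)

/-- The product of the diagonal entries of `M α b Ω n`, as a function of `θ = Theta α n`. -/
noncomputable def diagProd (α b Ω θ : ℝ) : ℝ :=
  (Ω - θ + b ^ 2 * Lam α 1 b) * (b * Ω + b ^ (1 - α) * θ - b * Lam α 1 b)

lemma contDiff_diagProd (α b Ω : ℝ) : ContDiff ℝ 1 (diagProd α b Ω) := by
  unfold diagProd
  fun_prop

lemma det_M_eq (α b Ω : ℝ) (n : ℕ) :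
    (M α b Ω n).det = diagProd α b Ω (Theta α n) + b ^ 3 * (Lam α n b * Lam α n b) := by
  rw [M, Matrix.det_fin_two_of, diagProd]
  ring

lemma diagProd_Lam_one_sub (α Ω : ℝ) {b : ℝ} (hb : 0 < b) (x : ℝ) :
    diagProd α b Ω (Lam α 1 1 - kappa α * x) =
      mu α b Ω + nu α b Ω * x - b ^ (1 - α) * kappa α ^ 2 * x ^ 2 := by
  have hrpow : b ^ (2 - α) = b * b ^ (1 - α) := by
    rw [mul_comm, ← Real.rpow_add_one hb.ne']
    ring_nf
  have hnu : nu α b Ω = kappa α * (2 * b ^ (1 - α) * Lam α 1 1 + (b - b ^ (1 - α)) * Ω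
      - b * (1 + b ^ (2 - α)) * Lam α 1 b) := by
    rw [nu, kappa]
    ring
  rw [hnu, hrpow, mu, diagProd]
  ring

lemma isBigO_det_M {α b : ℝ} (hα : α ∈ Ioo (0 : ℝ) 1) (hb : b ∈ Ioo (0 : ℝ) 1) (Ω : ℝ) :
    (fun n : ℕ => (M α b Ω n).det - (mu α b Ω + nu α b Ω / (n : ℝ) ^ (1 - α)
        - b ^ (1 - α) * kappa α ^ 2 / (n : ℝ) ^ (2 - 2 * α)))
      =O[atTop] (fun n : ℕ => 1 / (n : ℝ) ^ (2 - α)) := by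
  have hdiag : (fun n : ℕ => diagProd α b Ω (Theta α n) -
      diagProd α b Ω (Lam α 1 1 - kappa α / (n : ℝ) ^ (1 - α)))
        =O[atTop] (fun n : ℕ => 1 / (n : ℝ) ^ (2 - α)) :=
    (((contDiff_diagProd α b Ω).contDiffAt.hasStrictDerivAt one_ne_zero).isBigO_sub.comp_tendsto
      ((tendsto_Theta_atTop hα).prodMk_nhds (tendsto_Lam_one_sub_kappa_div hα.2))).trans
      (isBigO_Theta hα)
  have hoff : (fun n : ℕ => b ^ 3 * (Lam α n b * Lam α n b))
      =O[atTop] (fun n : ℕ => 1 / (n : ℝ) ^ (2 - α)) := by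
    simpa only [mul_one] using ((isBigO_Lam_one_div_rpow hα hb (2 - α)).mul
      ((tendsto_Lam_atTop hα hb).isBigO_one ℝ)).const_mul_left (b ^ 3)
  refine (hdiag.add hoff).congr_left fun n => ?_
  have hsq : (n : ℝ) ^ (2 - 2 * α) = ((n : ℝ) ^ (1 - α)) ^ 2 := by
    rw [← Real.rpow_mul_natCast n.cast_nonneg]
    ring_nf
  rw [det_M_eq, div_eq_mul_one_div (kappa α), diagProd_Lam_one_sub α Ω hb.1, hsq]
  ring

lemma tendsto_det_M {α b : ℝ} (hα : α ∈ Ioo (0 : ℝ) 1) (hb : b ∈ Ioo (0 : ℝ) 1) (Ω : ℝ) :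
    Tendsto (fun n : ℕ => (M α b Ω n).det) atTop (𝓝 (mu α b Ω)) := by
  have hLam := tendsto_Lam_atTop hα hb
  have hdiag := ((contDiff_diagProd α b Ω).continuous.tendsto _).comp (tendsto_Theta_atTop hα)
  have hlim := hdiag.add ((hLam.mul hLam).const_mul (b ^ 3))
  rw [mul_zero, mul_zero, add_zero] at hlim
  exact hlim.congr fun n => (det_M_eq α b Ω n).symm

end VState

theorem mainTheorem6 (α b : ℝ) (hα : α ∈ Ioo (0 : ℝ) 1) (hb : b ∈ Ioo (0 : ℝ) 1) :
    -- the integrals defining `Λ_n(β)`, `0 < β ≤ 1`, converge absolutely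
    (∀ n : ℕ, 1 ≤ n → ∀ β ∈ Ioc (0 : ℝ) 1,
      IntegrableOn (fun t => VState.lambdaIntegrand α n β t) (Ioi 0)) ∧
    -- (1) signs and monotonicity
    ((∀ n : ℕ, 1 ≤ n → 0 ≤ VState.Theta α n ∧ 0 ≤ VState.Lam α n b) ∧
      (∀ n : ℕ, 1 ≤ n → StrictMonoOn (fun β => VState.Lam α n β) (Ioo 0 1)) ∧
      StrictMonoOn (fun n : ℕ => VState.Theta α n) (Ici 1) ∧
      StrictAntiOn (fun n : ℕ => VState.Lam α n b) (Ici 1)) ∧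
    -- (2) limits as the exponent tends to 0 and to 1
    (∀ n : ℕ, 2 ≤ n →
      Tendsto (fun a : ℝ => VState.Theta a n) (𝓝[>] 0) (𝓝 (((n : ℝ) - 1) / (2 * n))) ∧
      Tendsto (fun a : ℝ => VState.Lam a n b) (𝓝[>] 0) (𝓝 (b ^ (n - 1) / (2 * n))) ∧
      Tendsto (fun a : ℝ => VState.Theta a n) (𝓝[<] 1)
        (𝓝 (2 / Real.pi * ∑ k ∈ Finset.Icc 1 (n - 1), 1 / (2 * (k : ℝ) + 1))) ∧
      ∃ I : ℝ,
        Tendsto (fun R : ℝ => ∫ t in (0 : ℝ)..R, VState.besselJ n (b * t) * VState.besselJ n t)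
          atTop (𝓝 I) ∧
        Tendsto (fun a : ℝ => VState.Lam a n b) (𝓝[<] 1) (𝓝 (1 / b * I))) ∧
    -- (3) asymptotics as `n → ∞`
    ((fun n : ℕ => VState.Lam α n b) =O[atTop] (fun n : ℕ => b ^ (n - 1)) ∧
      Tendsto (fun n : ℕ => VState.Lam α n b) atTop (𝓝 0) ∧
      (fun n : ℕ => VState.Theta α n -
          (VState.Lam α 1 1 - VState.kappa α / (n : ℝ) ^ (1 - α)))
        =O[atTop] (fun n : ℕ => 1 / (n : ℝ) ^ (2 - α)) ∧
      Tendsto (fun n : ℕ => VState.Theta α n) atTop (𝓝 (VState.Lam α 1 1))) ∧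
    -- (4) expansion of the determinant
    (∀ Ω : ℝ,
      (fun n : ℕ => (VState.M α b Ω n).det -
          (VState.mu α b Ω + VState.nu α b Ω / (n : ℝ) ^ (1 - α)
            - b ^ (1 - α) * VState.kappa α ^ 2 / (n : ℝ) ^ (2 - 2 * α)))
        =O[atTop] (fun n : ℕ => 1 / (n : ℝ) ^ (2 - α)) ∧
      Tendsto (fun n : ℕ => (VState.M α b Ω n).det) atTop (𝓝 (VState.mu α b Ω))) := by
  have hb' : b ∈ Ioc (0 : ℝ) 1 := Ioo_subset_Ioc_self hb
  exact ⟨fun n _ β hβ => VState.integrableOn_lambdaIntegrand hα n hβ.1,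
    ⟨fun n hn => ⟨VState.Theta_nonneg hα hn, (VState.Lam_pos hα hn hb').le⟩,
      fun n hn => (VState.strictMonoOn_Lam hα hn).mono Ioo_subset_Ioc_self,
      VState.strictMonoOn_Theta hα, VState.strictAntiOn_Lam hα hb'⟩,
    fun n hn => ⟨VState.tendsto_Theta_nhdsGT_zero (by omega),
      VState.tendsto_Lam_nhdsGT_zero (by omega) hb', VState.tendsto_Theta_nhdsLT_one (by omega),
      VState.exists_tendsto_integral_mul_besselJ n hb⟩,
    ⟨VState.isBigO_Lam hα hb', VState.tendsto_Lam_atTop hα hb, VState.isBigO_Theta hα,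
      VState.tendsto_Theta_atTop hα⟩,
    fun Ω => ⟨VState.isBigO_det_M hα hb Ω, VState.tendsto_det_M hα hb Ω⟩⟩
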